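/- **Setting.** Let $\lambda$ be the security parameter. All algorithms, honest or malicious, are probabilistic Boolean circuits of size polynomial in $\lambda$ (non-uniform polynomial time) with oracle access to two hash functions $H_1,H_2:\{0,1\}^*\to\mathbb Z_p$, modelled as independent random oracles. "Negligible" means smaller than every inverse polynomial in $\lambda$. Let $\mathbb G$ be a group of prime order $p$ (depending on $\lambda$) with efficient multiplication and a nondegenerate symmetric pairing $e$. *KZG.* $\mathsf{Setup}$ draws $g\in\mathbb G$ and $\alpha\in\mathbb Z_p$ uniformly and publishes $\mathsf{srs}=(g,g^{\alpha},\dots,g^{\alpha^D})$, with $D$ polynomially bounded in $\lambda$. $\mathsf{Commit}(\phi)=g^{\phi(\alpha)}$ is computed from $\mathsf{srs}$ for $\deg\phi\le D$. $\mathsf{VerifyEval}(C,j,v,\pi)$ accepts iff $e(C/g^{v},g)=e(\pi,g^{\alpha}/g^{j})$. *zk-SNARK.* $\mathsf{SNARK}=(\mathsf{Setup},\mathsf{Prove},\mathsf{Verify})$ is a zk-SNARK, with keys $\mathsf{pk},\mathsf{vk}$, for the relation with statements $(c,v,r)$ and witnesses $w\in\{0,1\}^*$ $$v=H_1(w)\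 \wedge\ r=H_2(c\,\|\,w).$$ *Batch.* The transactions of batch $i$ are $\mathrm{TX}_i=(\mathrm{TX}_i^{(0)},\dots,\mathrm{TX}_i^{(k-1)})$, with $k\le D$ and $\mathrm{TX}_i^{(j)}\in\{0,1\}^*$. The polynomial $\phi_i$ of degree less than $k$ interpolates $\phi_i(j)=H_1(\mathrm{TX}_i^{(j)})$ for $0\le j<k$, and the recorded hidden state is $\mathrm{hidden\_state}_{i+2}=\mathsf{Commit}(\phi_i)$. *Builder.* An efficient first stage, which comprises everything that happens before the deletion, gets $(\mathsf{srs},\mathsf{pk},\mathsf{vk})$ and outputs the parts $\mathrm{TX}_i^{(j)}$ and the memory $\mathsf{st}$ that the builder keeps. The builder *has deleted every part* if for every efficient algorithm $X$ the probability that $X(\mathsf{srs},\mathsf{pk},\mathsf{vk},\mathrm{hidden\_state}_{i+2},\mathsf{st})\in\{\mathrm{TX}_i^{(0)},\dots,\mathrm{TX}_i^{(k-1)}\}$ is negligible. Then a challenge $(i,c)$ with $c\in\{0,1\}^\lambda$ uniform is drawn. From $(\mathsf{srs},\mathsf{pk},\mathsf{vk},\mathrm{hidden\_state}_{i+2},\mathsf{st},c)$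 the builder efficiently computes a response $(j,v,\pi,r,\pi_v)$ with $0\le j<k$, $v,r\in\mathbb Z_p$, $\pi\in\mathbb G$. The arbiter contract accepts iff $$\mathsf{SNARK.Verify}(\mathsf{vk},(c,v,r),\pi_v)=1\quad\text{and}\quad \mathsf{KZG.VerifyEval}(\mathrm{hidden\_state}_{i+2},j,v,\pi)=1 .$$ **Theorem (Proof of Existence Soundness).** Assume that the $D$-strong Diffie–Hellman assumption holds in $\mathbb G$: given $\mathsf{srs}$, no efficient algorithm outputs a pair $(a,g^{1/(\alpha+a)})$ with $a \in \mathbb Z_p$, $\alpha+a\neq 0$, except with negligible probability. Assume that the zk-SNARK is sound as an argument of knowledge: for every efficient prover there is an efficient extractor which, from the prover's input $(\mathsf{pk},\mathsf{vk})$ and coins, outputs a witness for the prover's statement whenever the prover's proof is accepted, except with negligible probability. Then for every builder that has deleted every part $\mathrm{TX}_i^{(j)}$ of batch $i$, the probability that the arbiter contract accepts its response to the challenge $(i,c)$ is negligible. -/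

import Mathlib

noncomputable section

namespace PoE

/-! ## Asymptotics -/

/-- `f` is bounded by a polynomial in the security parameter. -/
def PolyBounded (f : ℕ → ℕ) : Prop :=
  ∃ P : Polynomial ℕ, ∀ n, f n ≤ P.eval n

/-- `f` is negligible: it decays faster than every inverse polynomial. -/
def Negligible (f : ℕ → ℝ) : Prop :=
  Asymptotics.SuperpolynomialDecay Filter.atTop (fun n : ℕ => (n : ℝ)) f

/-! ## The model of computation

Polynomial-time algorithms, honest or malicious, are probabilistic Boolean circuits of polynomial
size (non-uniform probabilistic polynomial time) with gates for the two hash functions. -/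

/-- A wire of a circuit: a bit of one of the input strings (`input s i` is bit `i` of string `s`,
and `false` if there is no such bit), or the value of an earlier gate. -/
inductive Wire where
  | input (s i : ℕ)
  | gate (i : ℕ)

/-- A gate: a constant, a NAND of two wires, or one bit of the (binary) value of the hash function
`H₁` (`t = 0`) or `H₂` (`t = 1`) at the string formed by the wires `args`. -/
inductive Gate where
  | const (b : Bool)
  | nand (a b : Wire)
  | hash (t : Fin 2) (args : List Wire) (bit : ℕ)

/-- A circuit with `m` output strings: a list of gates in order of evaluation, and for every
output string the list of the wires that carry it. -/
structure Circuit (m : ℕ) where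
  gates : List Gate
  outs : Fin m → List Wire

/-- The value of a wire on the input strings `x`, when the gates so far have the values `g`. -/
def Wire.val (x : List (List Bool)) (g : List Bool) : Wire → Bool
  | .input s i => (x.getD s []).getD i false
  | .gate i => g.getD i false

/-- The value of a gate; `O (0, ·)` and `O (1, ·)` are the two hash functions, with values in ℕ. -/
def Gate.val (O : Fin 2 × List Bool → ℕ) (x : List (List Bool)) (g : List Bool) : Gate → Bool
  | .const b => b
  | .nand a b => !(a.val x g && b.val x g)
  | .hash t args bit => (O (t, args.map (Wire.val x g))).testBit bit

/-- The cost of a gate: reading a query to a hash function is paid for bit by bit. -/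
def Gate.size : Gate → ℕ
  | .const _ => 1
  | .nand _ _ => 1
  | .hash _ args _ => args.length + 1

/-- The size of a circuit. -/
def Circuit.size {m : ℕ} (C : Circuit m) : ℕ :=
  (C.gates.map Gate.size).sum + ∑ k, (C.outs k).length

/-- The values of all gates, in order. -/
def Circuit.run {m : ℕ} (C : Circuit m) (O : Fin 2 × List Bool → ℕ) (x : List (List Bool)) :
    List Bool :=
  C.gates.foldl (fun g a => g ++ [a.val O x g]) []

/-- Output string number `k` of the circuit on the input strings `x`. -/
def Circuit.eval {m : ℕ} (C : Circuit m) (O : Fin 2 × List Bool → ℕ) (x : List (List Bool))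
    (k : Fin m) : List Bool :=
  (C.outs k).map (Wire.val x (C.run O x))

/-- A deterministic polynomial-size algorithm: at security parameter `n` a circuit with `m n`
output strings, of size polynomial in `n`. -/
structure DetAlgorithm (m : ℕ → ℕ) where
  circuit : ∀ n, Circuit (m n)
  poly : PolyBounded fun n => (circuit n).size

/-- A probabilistic polynomial-size algorithm: its circuit has `coins n` uniform random bits as its
last input string. -/
structure Algorithm (m : ℕ → ℕ) extends DetAlgorithm m where
  coins : ℕ → ℕ
  coins_poly : PolyBounded coins

/-- The output string number `k` of a deterministic algorithm. -/
def DetAlgorithm.out {m : ℕ → ℕ} (A : DetAlgorithm m) (n : ℕ) {p : ℕ}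
    (O : Fin 2 × List Bool → ZMod p) (x : List (List Bool)) (k : Fin (m n)) : List Bool :=
  (A.circuit n).eval (fun q => (O q).val) x k

/-- The output string number `k` of a probabilistic algorithm with the coins `ρ`. -/
def Algorithm.out {m : ℕ → ℕ} (A : Algorithm m) (n : ℕ) {p : ℕ}
    (O : Fin 2 × List Bool → ZMod p) (x : List (List Bool)) (ρ : Fin (A.coins n) → Bool)
    (k : Fin (m n)) : List Bool :=
  A.toDetAlgorithm.out n O (x ++ [List.ofFn ρ]) k

/-! ## Encodings -/

/-- Output strings of a circuit have a fixed length. A circuit hands out a string `s` of variable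
length in the padded form `s 1 0 ⋯ 0`, and `unpad` recovers `s`. -/
def unpad (y : List Bool) : List Bool :=
  (y.reverse.dropWhile fun b => !b).tail.reverse

theorem unpad_pad (s : List Bool) (m : ℕ) :
    unpad (s ++ true :: List.replicate m false) = s := by
  have h : ∀ m : ℕ, List.dropWhile (fun b => !b) (List.replicate m false ++ true :: s.reverse)
      = true :: s.reverse := by
    intro m
    induction m with
    | zero => simp
    | succ m ih => simp [List.replicate_succ, ih]
  simp [unpad, h]

/-- The binary expansion of a scalar, of the fixed length `Nat.size p`. -/
def encScalar {p : ℕ} (v : ZMod p) : List Bool :=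
  List.ofFn fun i : Fin (Nat.size p) => v.val.testBit i

/-! ## Probability -/

/-- The random oracle: independent uniform values in `ℤ_p` of `H₁` and `H₂` at all strings. -/
def randomOracle (p : ℕ) [Fact p.Prime] :
    MeasureTheory.Measure (Fin 2 × List Bool → ZMod p) :=
  MeasureTheory.Measure.infinitePi fun _ => (PMF.uniformOfFintype (ZMod p)).toMeasure

/-- The probability of `E O f` for a random oracle `O` and an independent uniform `f : F`. -/
def prob (p : ℕ) [Fact p.Prime] (F : Type) [Fintype F]
    (E : (Fin 2 × List Bool → ZMod p) → F → Prop) : ℝ :=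
  (∑ f : F, (randomOracle p).real {O | E O f}) / Fintype.card F

/-! ## Bilinear groups and the KZG commitment -/

/-- For every security parameter a group `G n` of prime order `p n` with a nondegenerate symmetric
pairing, an encoding of its elements as bit strings, and efficient multiplication. -/
structure BilinearGroup where
  p : ℕ → ℕ
  prime : ∀ n, (p n).Prime
  G : ℕ → Type
  GT : ℕ → Type
  commGroup : ∀ n, CommGroup (G n)
  fintype : ∀ n, Fintype (G n)
  commGroupT : ∀ n, CommGroup (GT n)
  card_G : ∀ n, Fintype.card (G n) = p n
  e : ∀ n, G n →* G n →* GT n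
  nondegenerate : ∀ n (g : G n), g ≠ 1 → e n g g ≠ 1
  encLen : ℕ → ℕ
  enc : ∀ n, G n → List Bool
  enc_length : ∀ n a, (enc n a).length = encLen n
  enc_injective : ∀ n, Function.Injective (enc n)
  mul_efficient : ∃ M : DetAlgorithm (fun _ => 1), ∀ n (O : Fin 2 × List Bool → ZMod (p n))
    (a b : G n), M.out n O [enc n a, enc n b] (0 : Fin 1) = enc n (a * b)

attribute [instance] BilinearGroup.commGroup BilinearGroup.fintype BilinearGroup.commGroupT

instance (𝔾 : BilinearGroup) (n : ℕ) : Fact (𝔾.p n).Prime := ⟨𝔾.prime n⟩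

namespace KZG

variable {p : ℕ} {G GT : Type} [CommGroup G] [CommGroup GT]

/-- The structured reference string `(g, g^α, …, g^(α^D))`. -/
def setup (D : ℕ) (g : G) (α : ZMod p) : Fin (D + 1) → G :=
  fun i => g ^ (α ^ (i : ℕ)).val

/-- The commitment `∏ (g^(α^i))^(φ_i)` to a polynomial `φ` of degree at most `D`. -/
def commit {D : ℕ} (srs : Fin (D + 1) → G) (φ : Polynomial (ZMod p)) : G :=
  ∏ i : Fin (D + 1), srs i ^ (φ.coeff i).val

/-- The check `e(C / g^v, g) = e(π, g^α / g^i)`. -/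
def VerifyEval (e : G →* G →* GT) {D : ℕ} (srs : Fin (D + 1) → G) (C : G) (i v : ZMod p) (π : G) :
    Prop :=
  e (C / srs 0 ^ v.val) (srs 0) = e π (srs 1 / srs 0 ^ i.val)

end KZG

/-- The encoding of a structured reference string. -/
def encSrs (𝔾 : BilinearGroup) (n : ℕ) {D : ℕ} (srs : Fin (D + 1) → 𝔾.G n) : List Bool :=
  (List.ofFn fun i => 𝔾.enc n (srs i)).flatten

/-- The `D`-strong Diffie–Hellman assumption: given `(g, g^α, …, g^(α^D))`, no efficient algorithm
outputs `(c, g^(1/(α + c)))`, except with negligible probability. -/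
def StrongDH (𝔾 : BilinearGroup) (D : ℕ → ℕ) : Prop :=
  ∀ A : Algorithm (fun _ => 2), Negligible fun n =>
    prob (𝔾.p n) (𝔾.G n × ZMod (𝔾.p n) × (Fin (A.coins n) → Bool)) fun O ω =>
      let g := ω.1
      let α := ω.2.1
      let out := A.out n O [encSrs 𝔾 n (KZG.setup (D n) g α)] ω.2.2
      ∃ (c : ZMod (𝔾.p n)) (h : 𝔾.G n),
        out (0 : Fin 2) = encScalar c ∧ out (1 : Fin 2) = 𝔾.enc n h ∧
          α + c ≠ 0 ∧ h ^ (α + c).val = g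

/-! ## The zk-SNARK -/

/-- The relation of the data check: the statement is `(c, v, r)`, the witness is a part `w` of the
transactions, and `v = H₁(w)`, `r = H₂(c, w)`, where `H₂(c, w)` is `H₂` at `c ‖ w`. -/
def Rel {p : ℕ} (O : Fin 2 × List Bool → ZMod p) (c : List Bool) (v r : ZMod p) (w : List Bool) :
    Prop :=
  v = O (0, w) ∧ r = O (1, c ++ w)

/-- The three algorithms of a zk-SNARK: `setup` outputs `(pk, vk)`; `prove` gets `pk`, the statement
`(c, v, r)` and the padded witness and outputs a proof; `verify` gets `vk`, the statement and a
proof, and accepts by the output `1`. -/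
structure Snark where
  setup : Algorithm (fun _ => 2)
  prove : Algorithm (fun _ => 1)
  verify : DetAlgorithm (fun _ => 1)

/-- The verifier accepts the proof `π` of the statement `(c, v, r)`. -/
def Snark.Accepts (S : Snark) (n : ℕ) {p : ℕ} (O : Fin 2 × List Bool → ZMod p) (vk : List Bool)
    (c : List Bool) (v r : ZMod p) (π : List Bool) : Prop :=
  S.verify.out n O [vk, c, encScalar v, encScalar r, π] (0 : Fin 1) = [true]

/-- Soundness of a succinct non-interactive argument *of knowledge* for `Rel`: for every efficient
prover there is an efficient extractor that, from the input and the coins of the prover, computes a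
witness whenever the prover outputs an accepted statement and proof, except with negligible
probability. A statement consists of a string `c` of `n` bits and of two scalars. -/
def KnowledgeSound (p : ℕ → ℕ) [∀ n, Fact (p n).Prime] (S : Snark) : Prop :=
  ∀ P : Algorithm (fun _ => 4), ∃ E : DetAlgorithm (fun _ => 1), Negligible fun n =>
    prob (p n) ((Fin (S.setup.coins n) → Bool) × (Fin (P.coins n) → Bool)) fun O ω =>
      let pk := S.setup.out n O [] ω.1 (0 : Fin 2)
      let vk := S.setup.out n O [] ω.1 (1 : Fin 2)
      let out := P.out n O [pk, vk] ω.2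
      let w := unpad (E.out n O [pk, vk, List.ofFn ω.2] (0 : Fin 1))
      let c := out (0 : Fin 4)
      ∃ v r : ZMod (p n),
        c.length = n ∧ out (1 : Fin 4) = encScalar v ∧ out (2 : Fin 4) = encScalar r ∧
          S.Accepts n O vk c v r (out (3 : Fin 4)) ∧ ¬ Rel O c v r w

/-! ## Proof of existence -/

/-- The polynomial of a batch: the interpolation of the points `(j, H₁(TX j))`, `j < k`. -/
def batchPoly {p : ℕ} [Fact p.Prime] (O : Fin 2 × List Bool → ZMod p) {k : ℕ}
    (TX : Fin k → List Bool) : Polynomial (ZMod p) :=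
  Lagrange.interpolate Finset.univ (fun j : Fin k => ((j : ℕ) : ZMod p)) fun j => O (0, TX j)

/-- A malicious builder.

`store` is everything that happens before the data is deleted, including the users and the rest of
the network: from `(srs, pk, vk)` it outputs the `k n` (padded) parts of the transactions of the
batch, and the memory that the builder keeps.

`respond` is the builder after the deletion: from `(srs, pk, vk)`, the hidden state, the memory and
the challenge `c` it outputs a response `(j, v, π, r, π_v)`. -/
structure Builder (k : ℕ → ℕ) where
  store : Algorithm (fun n => k n + 1)
  respond : Algorithm (fun _ => 5)

section Game

variable (𝔾 : BilinearGroup) (S : Snark) (D : ℕ → ℕ) {k : ℕ → ℕ} (B : Builder k)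

/-- The randomness of a batch up to the deletion: `g` and `α` of the KZG setup, the coins of the
setup of the zk-SNARK, and the coins of `store`. -/
abbrev History (n : ℕ) : Type :=
  𝔾.G n × ZMod (𝔾.p n) × (Fin (S.setup.coins n) → Bool) × (Fin (B.store.coins n) → Bool)

variable {n : ℕ} (O : Fin 2 × List Bool → ZMod (𝔾.p n)) (ω : History 𝔾 S B n)

def srs : Fin (D n + 1) → 𝔾.G n := KZG.setup (D n) ω.1 ω.2.1

def provingKey : List Bool := S.setup.out n O [] ω.2.2.1 (0 : Fin 2)

def verificationKey : List Bool := S.setup.out n O [] ω.2.2.1 (1 : Fin 2)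

/-- The public parameters `(srs, pk, vk)` as strings. -/
def publicParams : List (List Bool) :=
  [encSrs 𝔾 n (srs 𝔾 S D B ω), provingKey 𝔾 S B O ω, verificationKey 𝔾 S B O ω]

/-- The part number `j` of the transactions of the batch. -/
def part (j : Fin (k n)) : List Bool :=
  unpad (B.store.out n O (publicParams 𝔾 S D B O ω) ω.2.2.2 j.castSucc)

/-- What the builder keeps in its memory. -/
def memory : List Bool :=
  B.store.out n O (publicParams 𝔾 S D B O ω) ω.2.2.2 (Fin.last (k n))

/-- The hidden state that L1 records for the batch (in the header of the second next batch): the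
KZG commitment to the polynomial of the batch. -/
def hiddenState : 𝔾.G n :=
  KZG.commit (srs 𝔾 S D B ω) (batchPoly O (part 𝔾 S D B O ω))

/-- Everything that the builder has after the deletion: the public data and its memory. -/
def view : List (List Bool) :=
  publicParams 𝔾 S D B O ω ++ [𝔾.enc n (hiddenState 𝔾 S D B O ω), memory 𝔾 S D B O ω]

/-- The arbiter contract accepts the response `(j, v, π, r, π_v)` to the challenge `c`. -/
def ArbiterAccepts (c : List Bool) (j : Fin (k n)) (v : ZMod (𝔾.p n)) (π : 𝔾.G n)
    (r : ZMod (𝔾.p n)) (πv : List Bool) : Prop :=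
  S.Accepts n O (verificationKey 𝔾 S B O ω) c v r πv ∧
    KZG.VerifyEval (𝔾.e n) (srs 𝔾 S D B ω) (hiddenState 𝔾 S D B O ω) ((j : ℕ) : ZMod (𝔾.p n)) v π

/-- The builder has deleted all parts of the batch: what it has left does not enable any efficient
algorithm to recover one of the parts, except with negligible probability. -/
def DeletesAllParts : Prop :=
  ∀ X : Algorithm (fun _ => 1), Negligible fun n =>
    prob (𝔾.p n) (History 𝔾 S B n × (Fin (X.coins n) → Bool)) fun O ω =>
      ∃ j : Fin (k n),
        unpad (X.out n O (view 𝔾 S D B O ω.1) ω.2 (0 : Fin 1)) = part 𝔾 S D B O ω.1 j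

/-- The probability that the arbiter contract accepts the builder's response to a uniformly random
challenge `c` of `n` bits, which is drawn after the deletion. -/
def acceptProb (n : ℕ) : ℝ :=
  prob (𝔾.p n) (History 𝔾 S B n × (Fin n → Bool) × (Fin (B.respond.coins n) → Bool)) fun O ω =>
    let c := List.ofFn ω.2.1
    let out := B.respond.out n O (view 𝔾 S D B O ω.1 ++ [c]) ω.2.2
    ∃ (j : Fin (k n)) (v : ZMod (𝔾.p n)) (π : 𝔾.G n) (r : ZMod (𝔾.p n)),
      out (0 : Fin 5) = encScalar ((j : ℕ) : ZMod (𝔾.p n)) ∧ out (1 : Fin 5) = encScalar v ∧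
        out (2 : Fin 5) = 𝔾.enc n π ∧ out (3 : Fin 5) = encScalar r ∧
          ArbiterAccepts 𝔾 S D B O ω.1 c j v π r (out (4 : Fin 5))

end Game

end PoE

end

/-! Suppose that a response `(j, v, π, r, π_v)` is accepted, and let `w_j` be the part at position
`j`. Two degenerate events are set aside: `g = 1`, where the pairing check says nothing, and `p <
k`, where the nodes `0, …, k - 1` collide modulo `p`. They cost `1/p` and `k/p`, and `1/p` is
negligible because a constant answer to the strong Diffie–Hellman problem is right with probability
of order `1/p` (`negligible_inv_p`). Three cases remain (`acceptProb_le`).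

False value, `v ≠ H₁(w_j)`. Write `φ = (X - j) q + φ(j)`. The accepted opening says `g^(φ(α) - v) =
π^(α - j)`, hence `(π / g^(q(α)))^(1/(φ(j) - v))` equals `g^(1/(α - j))`, which is a strong
Diffie–Hellman solution with `a = -j` (`strongDH_solution`, `exists_strongDH_circuit`).

True value, but `r ≠ H₂(c ‖ w_j)`. The extractor gives `w` with `H₁(w) = v` and `H₂(c ‖ w) = r`. So
`w ≠ w_j`, although `H₁(w) = H₁(w_j)`: a collision among polynomially many queries, excluded by the
birthday bound (`QTree.real_collision_le`).

True second hash, `r = H₂(c ‖ w_j)`. If `c ‖ w_j` was not queried, then `r` is a guess of a uniform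
value (`QTree.real_predict_le`). A query made before `c` was drawn begins with `c` with probability
at most `2^(-n)`. If the builder makes the query after the deletion, then deleting the first `n`
bits of this query recovers a part, against the deletion hypothesis (`exists_recovery_circuit`).

Adversaries are non-uniform. So a reduction may fix all randomness that is not its own at the best
value (`exists_prob_le`) and guess an index below `N` at the cost of a factor `N`
(`exists_prob_exists_le`). What has to be shown is that the reductions are circuits of polynomial
size: `Der A B s` is a calculus of straight-line programs whose costs add up, and
`Der.exists_circuit` turns a derivation into a circuit. For the oracle, `QTree` describes adaptive
queries, and `real_le_inv_of_update` bounds events that do not survive resampling of one value. -/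

noncomputable section

namespace PoE

/-! ## Polynomial bounds and negligible functions -/

namespace PolyBounded

theorem mono {f g : ℕ → ℕ} (hg : PolyBounded g) (h : ∀ n, f n ≤ g n) : PolyBounded f :=
  let ⟨P, hP⟩ := hg
  ⟨P, fun n => (h n).trans (hP n)⟩

theorem const (c : ℕ) : PolyBounded fun _ => c := ⟨Polynomial.C c, fun n => by simp⟩

theorem id : PolyBounded fun n => n := ⟨Polynomial.X, fun n => by simp⟩

theorem add {f g : ℕ → ℕ} (hf : PolyBounded f) (hg : PolyBounded g) :
    PolyBounded fun n => f n + g n :=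
  let ⟨P, hP⟩ := hf
  let ⟨Q, hQ⟩ := hg
  ⟨P + Q, fun n => by simpa using add_le_add (hP n) (hQ n)⟩

theorem mul {f g : ℕ → ℕ} (hf : PolyBounded f) (hg : PolyBounded g) :
    PolyBounded fun n => f n * g n :=
  let ⟨P, hP⟩ := hf
  let ⟨Q, hQ⟩ := hg
  ⟨P * Q, fun n => by simpa using Nat.mul_le_mul (hP n) (hQ n)⟩

end PolyBounded

namespace Negligible

theorem mono {f g : ℕ → ℝ} (hg : Negligible g) (h0 : ∀ n, 0 ≤ f n) (h : ∀ n, f n ≤ g n) :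
    Negligible f :=
  Asymptotics.SuperpolynomialDecay.trans_abs_le hg fun n => by
    rw [abs_of_nonneg (h0 n), abs_of_nonneg ((h0 n).trans (h n))]
    exact h n

theorem add {f g : ℕ → ℝ} (hf : Negligible f) (hg : Negligible g) :
    Negligible fun n => f n + g n :=
  Asymptotics.SuperpolynomialDecay.add hf hg

theorem poly_mul {f : ℕ → ℝ} {P : ℕ → ℕ} (hf : Negligible f) (h0 : ∀ n, 0 ≤ f n)
    (hP : PolyBounded P) : Negligible fun n => P n * f n := by
  obtain ⟨Q, hQ⟩ := hP
  have h := Asymptotics.SuperpolynomialDecay.polynomial_mul hf (Q.map (Nat.castRingHom ℝ))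
  refine mono h (fun n => mul_nonneg (Nat.cast_nonneg _) (h0 n)) fun n => ?_
  refine mul_le_mul_of_nonneg_right ?_ (h0 n)
  have : ((Q.eval n : ℕ) : ℝ) = (Q.map (Nat.castRingHom ℝ)).eval (n : ℝ) := by
    simp [Polynomial.eval_map, Polynomial.eval₂_at_natCast]
  rw [← this]
  exact_mod_cast hQ n

theorem inv_two_pow : Negligible fun n => ((2 : ℝ) ^ n)⁻¹ := by
  intro k
  have := tendsto_pow_const_mul_const_pow_of_abs_lt_one k (r := (1 / 2 : ℝ))
    (by rw [abs_of_pos] <;> norm_num)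
  simpa using this

end Negligible

/-! ## Probabilities -/

section Prob

open MeasureTheory

variable (p : ℕ) [Fact p.Prime]

instance : IsProbabilityMeasure (randomOracle p) := by
  unfold randomOracle; infer_instance

variable {p} {F F₁ F₂ : Type} [Fintype F] [Fintype F₁] [Fintype F₂]
  {E E' : (Fin 2 × List Bool → ZMod p) → F → Prop}

theorem prob_nonneg : 0 ≤ prob p F E := by
  unfold prob; positivity

theorem prob_mono (h : ∀ O f, E O f → E' O f) : prob p F E ≤ prob p F E' := by
  unfold prob
  gcongr with f
  · exact measure_ne_top _ _
  · exact h _ _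

/-- Monotonicity and subadditivity hold for arbitrary sets of oracles, so union bounds need no
measurability of the events. -/
theorem prob_or_le : prob p F (fun O f => E O f ∨ E' O f) ≤ prob p F E + prob p F E' := by
  unfold prob
  rw [← add_div, ← Finset.sum_add_distrib]
  gcongr with f
  exact measureReal_union_le _ _

theorem prob_le_of_forall {c : ℝ} (hc : 0 ≤ c)
    (h : ∀ f, (randomOracle p).real {O | E O f} ≤ c) : prob p F E ≤ c := by
  unfold prob
  refine div_le_of_le_mul₀ (by positivity) hc ?_
  calc _ ≤ ∑ _f : F, c := Finset.sum_le_sum fun f _ => h f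
    _ = _ := by simp [mul_comm]

theorem prob_le_one : prob p F E ≤ 1 := prob_le_of_forall zero_le_one fun _ => measureReal_le_one

theorem prob_false : prob p F (fun _ _ => False) = 0 := by simp [prob]

/-- Part of the randomness can be fixed in the best way. -/
theorem exists_prob_le (e : F₁ × F₂ ≃ F) [Nonempty F₂] :
    ∃ f₂, prob p F E ≤ prob p F₁ fun O f₁ => E O (e (f₁, f₂)) := by
  by_contra! h
  have h1 : prob p F E
      = (∑ f₂, prob p F₁ fun O f₁ => E O (e (f₁, f₂))) / Fintype.card F₂ := by
    unfold prob
    rw [← Finset.sum_div, div_div, ← Fintype.card_congr e, Fintype.card_prod, Nat.cast_mul,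
      ← e.sum_comp, Fintype.sum_prod_type_right]
  -- If every choice of `f₂` fell short of the mean, so would their average; `F₂` is nonempty, which
  -- makes the inequality strict.
  have h2 : (∑ f₂, prob p F₁ fun O f₁ => E O (e (f₁, f₂))) < ∑ _f₂ : F₂, prob p F E :=
    Finset.sum_lt_sum_of_nonempty Finset.univ_nonempty fun f _ => h f
  have h3 : (0 : ℝ) < Fintype.card F₂ := by exact_mod_cast Fintype.card_pos
  rw [Finset.sum_const, Finset.card_univ, nsmul_eq_mul] at h2
  rw [eq_div_iff h3.ne'] at h1
  linarith

/-- Of finitely many events one is the most probable. -/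
theorem exists_prob_exists_le (N : ℕ) (E : ℕ → (Fin 2 × List Bool → ZMod p) → F → Prop) :
    ∃ b, prob p F (fun O f => ∃ b < N, E b O f) ≤ N * prob p F (E b) := by
  have h : prob p F (fun O f => ∃ b < N, E b O f) ≤ ∑ b ∈ Finset.range N, prob p F (E b) := by
    induction N with
    | zero => simp [prob_false]
    | succ N ih =>
      rw [Finset.sum_range_succ]
      refine le_trans ?_ (add_le_add_left ih _)
      refine le_trans (prob_mono fun O f hb => ?_) prob_or_le
      obtain ⟨b, hb, h⟩ := hb
      rcases Nat.lt_succ_iff_lt_or_eq.1 hb with hb | rfl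
      · exact Or.inl ⟨b, hb, h⟩
      · exact Or.inr h
  rcases Nat.eq_zero_or_pos N with rfl | hN
  · exact ⟨0, by simpa using h⟩
  obtain ⟨b, -, hb⟩ := Finset.exists_max_image (Finset.range N) (fun b => prob p F (E b))
    ⟨0, by simpa using hN⟩
  refine ⟨b, h.trans ((Finset.sum_le_sum hb).trans ?_)⟩
  simp

end Prob

/-! ## Circuits that compute given signals

A signal is a bit that depends on a point `ω` of a space `Ω` of situations. -/

section Derivation

/-- The values of a list of gates. -/
def runGates (gs : List Gate) (O : Fin 2 × List Bool → ℕ) (x : List (List Bool)) : List Bool :=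
  gs.foldl (fun g a => g ++ [a.val O x g]) []

theorem runGates_concat (gs : List Gate) (a : Gate) (O : Fin 2 × List Bool → ℕ)
    (x : List (List Bool)) :
    runGates (gs ++ [a]) O x = runGates gs O x ++ [a.val O x (runGates gs O x)] := by
  simp [runGates]

theorem length_runGates (gs : List Gate) (O : Fin 2 × List Bool → ℕ) (x : List (List Bool)) :
    (runGates gs O x).length = gs.length := by
  induction gs using List.reverseRecOn with
  | nil => rfl
  | append_singleton gs a ih => simp [runGates_concat, ih]

theorem runGates_prefix (gs gs' : List Gate) (O : Fin 2 × List Bool → ℕ)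
    (x : List (List Bool)) : runGates gs O x <+: runGates (gs ++ gs') O x := by
  induction gs' using List.reverseRecOn with
  | nil => simp
  | append_singleton gs' a ih =>
    rw [← List.append_assoc, runGates_concat]
    exact ih.trans (List.prefix_append _ _)

theorem runGates_take (gs : List Gate) (O : Fin 2 × List Bool → ℕ) (x : List (List Bool)) (b : ℕ) :
    runGates (gs.take b) O x = (runGates gs O x).take b := by
  have h := runGates_prefix (gs.take b) (gs.drop b) O x
  rw [List.take_append_drop] at h
  rw [List.prefix_iff_eq_take.1 h, length_runGates, List.length_take]
  rcases le_total b gs.length with hb | hb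
  · rw [min_eq_left hb]
  · rw [min_eq_right hb, List.take_of_length_le (by rw [length_runGates]),
      List.take_of_length_le (by rw [length_runGates]; exact hb)]

/-- The total size of a list of gates. -/
def gatesSize (gs : List Gate) : ℕ := (gs.map Gate.size).sum

theorem gatesSize_append (gs gs' : List Gate) :
    gatesSize (gs ++ gs') = gatesSize gs + gatesSize gs' := by
  simp [gatesSize]

variable {Ω : Type} (orc : Ω → Fin 2 × List Bool → ℕ) (inp : Ω → List (List Bool))

/-- A wire that more gates do not affect. -/
def Wire.Stable (N : ℕ) : Wire → Prop
  | .input _ _ => True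
  | .gate i => i < N

/-- The signal `f` is the value of a wire. -/
def Available (gs : List Gate) (f : Ω → Bool) : Prop :=
  ∃ w : Wire, w.Stable gs.length ∧ ∀ ω, w.val (inp ω) (runGates gs (orc ω) (inp ω)) = f ω

variable {orc inp}

/-- Stability of the wire is essential: a wire to a gate that does not exist yet reads the default
`false`, and further gates would change it. -/
theorem Available.append {gs : List Gate} {f : Ω → Bool} (h : Available orc inp gs f)
    (gs' : List Gate) : Available orc inp (gs ++ gs') f := by
  obtain ⟨w, hw, hf⟩ := h
  cases w with
  | input s i => exact ⟨.input s i, trivial, hf⟩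
  | gate i =>
    have hi : i < gs.length := hw
    refine ⟨.gate i, ?_, fun ω => ?_⟩
    · simp only [Wire.Stable, List.length_append]; omega
    · rw [← hf ω]
      obtain ⟨t, ht⟩ := runGates_prefix gs gs' (orc ω) (inp ω)
      simp only [Wire.val, ← ht]
      exact List.getD_append _ _ _ _ (by rwa [length_runGates])

theorem Available.last (gs : List Gate) (a : Gate) (f : Ω → Bool)
    (h : ∀ ω, a.val (orc ω) (inp ω) (runGates gs (orc ω) (inp ω)) = f ω) :
    Available orc inp (gs ++ [a]) f := by
  refine ⟨.gate gs.length, by simp [Wire.Stable], fun ω => ?_⟩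
  simp only [Wire.val, runGates_concat]
  rw [List.getD_append_right _ _ _ _ (by rw [length_runGates]), length_runGates, h]
  simp

variable (orc inp)

/-- From the signals in `A` (and constants) the signals in `B` can be computed with gates of total
size at most `s`. -/
def Der (A B : Set (Ω → Bool)) (s : ℕ) : Prop :=
  ∀ gs : List Gate, (∀ b, Available orc inp gs fun _ => b) → (∀ f ∈ A, Available orc inp gs f) →
    ∃ gs', gatesSize gs' ≤ s ∧ ∀ f ∈ B, Available orc inp (gs ++ gs') f

/-- The constant signals. -/
def consts (Ω : Type) : Set (Ω → Bool) := Set.range fun b _ => b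

variable {orc inp} {A A' B B' C : Set (Ω → Bool)} {s s' t : ℕ}

namespace Der

theorem of_subset (h : B ⊆ A ∪ consts Ω) : Der orc inp A B 0 := by
  intro gs hc hA
  refine ⟨[], by simp [gatesSize], fun f hf => ?_⟩
  rw [List.append_nil]
  rcases h hf with h | ⟨b, rfl⟩
  · exact hA f h
  · exact hc b

theorem mono (h : Der orc inp A B s) (hA : A ⊆ A' ∪ consts Ω) (hB : B' ⊆ B ∪ consts Ω)
    (hs : s ≤ s') : Der orc inp A' B' s' := by
  intro gs hc hA'
  obtain ⟨gs', hs', hg⟩ := h gs hc fun f hf => by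
    rcases hA hf with h | ⟨b, rfl⟩
    · exact hA' f h
    · exact hc b
  refine ⟨gs', hs'.trans hs, fun f hf => ?_⟩
  rcases hB hf with h | ⟨b, rfl⟩
  · exact hg f h
  · exact (hc b).append _

theorem le (h : Der orc inp A B s) (hs : s ≤ s') : Der orc inp A B s' :=
  h.mono Set.subset_union_left Set.subset_union_left hs

theorem left (h : Der orc inp A B s) (hA : A ⊆ A') : Der orc inp A' B s :=
  h.mono (hA.trans Set.subset_union_left) Set.subset_union_left le_rfl

theorem right (h : Der orc inp A B s) (hB : B' ⊆ B ∪ consts Ω) : Der orc inp A B' s :=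
  h.mono Set.subset_union_left hB le_rfl

theorem trans (h : Der orc inp A B s) (h' : Der orc inp (A ∪ B) C t) :
    Der orc inp A C (s + t) := by
  intro gs hc hA
  obtain ⟨g₁, hs, h₁⟩ := h gs hc hA
  obtain ⟨g₂, ht, h₂⟩ := h' (gs ++ g₁) (fun b => (hc b).append _) (by
    rintro f (hf | hf)
    · exact (hA f hf).append _
    · exact h₁ f hf)
  refine ⟨g₁ ++ g₂, by rw [gatesSize_append]; omega, fun f hf => ?_⟩
  rw [← List.append_assoc]
  exact h₂ f hf

theorem union (h : Der orc inp A B s) (h' : Der orc inp A C t) :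
    Der orc inp A (B ∪ C) (s + t) := by
  intro gs hc hA
  obtain ⟨g₁, hs, h₁⟩ := h gs hc hA
  obtain ⟨g₂, ht, h₂⟩ := h' (gs ++ g₁) (fun b => (hc b).append _) fun f hf => (hA f hf).append _
  refine ⟨g₁ ++ g₂, by rw [gatesSize_append]; omega, ?_⟩
  rw [← List.append_assoc]
  rintro f (hf | hf)
  · exact (h₁ f hf).append _
  · exact h₂ f hf

theorem trans' (h : Der orc inp A B s) (h' : Der orc inp B C t) : Der orc inp A C (s + t) :=
  h.trans (h'.left Set.subset_union_right)

theorem self_union (h : Der orc inp A B s) : Der orc inp A (A ∪ B) s := by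
  simpa using (of_subset (A := A) (B := A) Set.subset_union_left).union h

theorem iUnion_lt {B : ℕ → Set (Ω → Bool)} (m : ℕ) (h : ∀ i < m, Der orc inp A (B i) s) :
    Der orc inp A (⋃ i < m, B i) (m * s) := by
  induction m with
  | zero => simpa using of_subset (A := A) (B := ∅) (by simp)
  | succ m ih =>
    rw [Set.biUnion_lt_succ, Nat.succ_mul]
    exact (ih fun i hi => h i (by omega)).union (h m (by omega))

theorem iUnion_fin {m : ℕ} {B : Fin m → Set (Ω → Bool)} (h : ∀ i, Der orc inp A (B i) s) :
    Der orc inp A (⋃ i, B i) (m * s) := by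
  have := iUnion_lt (A := A) (s := s) (orc := orc) (inp := inp)
    (B := fun i => if h : i < m then B ⟨i, h⟩ else ∅) m fun i hi => by simpa [hi] using h ⟨i, hi⟩
  refine this.right (Set.Subset.trans ?_ Set.subset_union_left)
  refine Set.iUnion_subset fun i f hf => ?_
  simp only [Set.mem_iUnion]
  exact ⟨i, i.2, by simpa using hf⟩

/-- A loop of `m` rounds: each round may use the fixed signals `A` and the state left by the round
before. Powers, carries and hashes of padded strings are computed in this way. -/
theorem iterate {B : ℕ → Set (Ω → Bool)} (m : ℕ)
    (h : ∀ i < m, Der orc inp (A ∪ B i) (B (i + 1)) s) :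
    Der orc inp (A ∪ B 0) (B m) (m * s) := by
  induction m with
  | zero => simpa using of_subset (A := A ∪ B 0) (B := B 0) (fun f hf => .inl (.inr hf))
  | succ m ih =>
    rw [Nat.succ_mul]
    exact (ih fun i hi => h i (by omega)).trans ((h m (by omega)).left
      (Set.union_subset_union_left _ Set.subset_union_left))

theorem nand {f g : Ω → Bool} (hf : f ∈ A ∪ consts Ω) (hg : g ∈ A ∪ consts Ω) :
    Der orc inp A {fun ω => !(f ω && g ω)} 1 := by
  intro gs hc hA
  have key : ∀ f ∈ A ∪ consts Ω, Available orc inp gs f := by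
    rintro f (h | ⟨b, rfl⟩)
    · exact hA f h
    · exact hc b
  obtain ⟨w, -, hw⟩ := key f hf
  obtain ⟨w', -, hw'⟩ := key g hg
  refine ⟨[.nand w w'], by simp [gatesSize, Gate.size], ?_⟩
  rintro _ rfl
  exact Available.last _ _ _ fun ω => by simp [Gate.val, hw, hw']

theorem hash (t : Fin 2) (fs : List (Ω → Bool)) (hfs : ∀ f ∈ fs, f ∈ A ∪ consts Ω) (bit : ℕ) :
    Der orc inp A {fun ω => (orc ω (t, fs.map fun f => f ω)).testBit bit} (fs.length + 1) := by
  intro gs hc hA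
  have key : ∀ f ∈ A ∪ consts Ω, Available orc inp gs f := by
    rintro f (h | ⟨b, rfl⟩)
    · exact hA f h
    · exact hc b
  have : ∃ ws : List Wire, ws.length = fs.length ∧
      ∀ ω, ws.map (Wire.val (inp ω) (runGates gs (orc ω) (inp ω))) = fs.map fun f => f ω := by
    clear hA
    induction fs with
    | nil => exact ⟨[], by simp⟩
    | cons f fs ih =>
      obtain ⟨ws, hl, hws⟩ := ih fun g hg => hfs g (by simp [hg])
      obtain ⟨w, -, hw⟩ := key f (hfs f (by simp))
      exact ⟨w :: ws, by simp [hl], fun ω => by simp [hw, hws]⟩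
  obtain ⟨ws, hl, hws⟩ := this
  refine ⟨[.hash t ws bit], by simp [gatesSize, Gate.size, hl], ?_⟩
  rintro _ rfl
  exact Available.last _ _ _ fun ω => by simp [Gate.val, hws]

/-- The multiplexer is `(c NAND f) NAND (¬c NAND g)`, with `¬c` obtained as `c NAND true`. -/
theorem mux {c f g : Ω → Bool} (hc : c ∈ A ∪ consts Ω) (hf : f ∈ A ∪ consts Ω)
    (hg : g ∈ A ∪ consts Ω) : Der orc inp A {fun ω => if c ω then f ω else g ω} 4 := by
  have h1 : Der orc inp A {fun ω => !(c ω && true)} 1 := nand hc (.inr ⟨true, rfl⟩)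
  have h2 : Der orc inp A {fun ω => !(c ω && f ω)} 1 := nand hc hf
  have h3 := h2.union (h1.trans (nand (f := fun ω => !(c ω && true)) (g := g) (by simp)
    (hg.imp_left Or.inl)))
  refine (h3.trans (nand (f := fun ω => !(c ω && f ω))
    (g := fun ω => !(!(c ω && true) && g ω)) (by simp) (by simp))).mono
    Set.subset_union_left (Set.Subset.trans (Set.singleton_subset_iff.2 ?_) Set.subset_union_left)
    le_rfl
  simp only [Set.mem_singleton_iff]
  funext ω
  cases c ω <;> simp

theorem mux_fun {c : Ω → Bool} {F : Bool → Ω → Bool} (hc : c ∈ A ∪ consts Ω)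
    (h : ∀ b, Der orc inp A {F b} s) : Der orc inp A {fun ω => F (c ω) ω} (2 * s + 4) := by
  have h1 := ((h true).union (h false)).trans (mux (c := c) (f := F true) (g := F false)
    (hc.imp_left Or.inl) (by simp) (by simp))
  have h2 : (fun ω => F (c ω) ω) = fun ω => if c ω then F true ω else F false ω := by
    funext ω; cases c ω <;> simp
  rw [h2]
  exact h1.le (by omega)

/-- Expansion by cases on one argument after the other. Each level doubles the cost and adds a
multiplexer: `0, 4, 12, 28`. -/
theorem bool₃ (F : Bool → Bool → Bool → Bool) {f g h : Ω → Bool} (hf : f ∈ A ∪ consts Ω)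
    (hg : g ∈ A ∪ consts Ω) (hh : h ∈ A ∪ consts Ω) :
    Der orc inp A {fun ω => F (f ω) (g ω) (h ω)} 28 :=
  mux_fun (F := fun b ω => F b (g ω) (h ω)) (s := 12) hf fun a =>
    mux_fun (F := fun b ω => F a b (h ω)) (s := 4) hg fun b =>
      mux_fun (F := fun c _ => F a b c) (s := 0) hh fun c =>
        of_subset (Set.singleton_subset_iff.2 (.inr ⟨F a b c, rfl⟩))

end Der

/-! ### Strings of signals -/

/-- The bits of an encoded object. -/
def codeBits {R : Type} (c : R → ℕ → Bool) (a : Ω → R) : Set (Ω → Bool) :=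
  Set.range fun i ω => c (a ω) i

/-- The bits of a string. -/
def strBits (y : Ω → List Bool) : Set (Ω → Bool) := codeBits (fun y i => y.getD i false) y

/-- The bits of a list of strings. -/
def inBits (xs : Ω → List (List Bool)) : Set (Ω → Bool) :=
  Set.range fun (q : ℕ × ℕ) ω => ((xs ω).getD q.1 []).getD q.2 false

theorem codeBits_const {R : Type} (c : R → ℕ → Bool) (a : R) :
    codeBits c (fun _ : Ω => a) ⊆ consts Ω := by
  rintro _ ⟨i, rfl⟩
  exact ⟨c a i, rfl⟩

theorem inBits_nil : inBits (fun _ : Ω => []) ⊆ consts Ω := by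
  rintro _ ⟨i, rfl⟩
  exact ⟨false, by simp⟩

theorem inBits_cons {y : Ω → List Bool} {xs : Ω → List (List Bool)}
    (hy : strBits y ⊆ A ∪ consts Ω) (hxs : inBits xs ⊆ A ∪ consts Ω) :
    inBits (fun ω => y ω :: xs ω) ⊆ A ∪ consts Ω := by
  rintro _ ⟨⟨s, i⟩, rfl⟩
  cases s with
  | zero => exact hy ⟨i, by simp⟩
  | succ s => exact hxs ⟨⟨s, i⟩, by simp⟩

theorem strBits_subset_inBits {xs : Ω → List (List Bool)} {y : Ω → List Bool} (s : ℕ)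
    (h : ∀ ω, (xs ω).getD s [] = y ω) : strBits y ⊆ inBits xs := by
  rintro _ ⟨i, rfl⟩
  exact ⟨⟨s, i⟩, by funext ω; simp only [h]⟩

theorem Der.ofBits {R : Type} {c : R → ℕ → Bool} {a : Ω → R} (N : ℕ)
    (hN : ∀ ω, ∀ i ≥ N, c (a ω) i = false) (h : ∀ i < N, Der orc inp A {fun ω => c (a ω) i} s) :
    Der orc inp A (codeBits c a) (N * s) := by
  refine (Der.iUnion_lt (B := fun i => {fun ω => c (a ω) i}) N h).right ?_
  rintro _ ⟨i, rfl⟩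
  rcases lt_or_ge i N with hi | hi
  · exact .inl (by simp only [Set.mem_iUnion]; exact ⟨i, hi, rfl⟩)
  · exact .inr ⟨false, by funext ω; simp [hN ω i hi]⟩

theorem Der.select {R : Type} {c : R → ℕ → Bool} {a b : Ω → R} {f : Ω → Bool} (N : ℕ)
    (hN : ∀ r, ∀ i ≥ N, c r i = false) (hf : f ∈ A ∪ consts Ω)
    (ha : codeBits c a ⊆ A ∪ consts Ω) (hb : codeBits c b ⊆ A ∪ consts Ω) :
    Der orc inp A (codeBits c fun ω => if f ω then a ω else b ω) (N * 4) := by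
  refine Der.ofBits N (fun ω => hN _) fun i _ => ?_
  have := Der.mux (orc := orc) (inp := inp) hf (ha ⟨i, rfl⟩) (hb ⟨i, rfl⟩)
  refine this.right (Set.singleton_subset_iff.2 (.inl ?_))
  simp only [Set.mem_singleton_iff]
  funext ω
  cases f ω <;> simp

/-! ### Running a circuit as a part of another circuit -/

/-- All the values that occur when gates are evaluated. -/
def stageBits (orc : Ω → Fin 2 × List Bool → ℕ) (gs : List Gate) (xs : Ω → List (List Bool)) :
    Set (Ω → Bool) :=
  Set.range fun (q : Wire × ℕ) ω => q.1.val (xs ω) ((runGates gs (orc ω) (xs ω)).take q.2)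

/-- The gates are copied one by one. A wire may point to a gate that is evaluated later, and then
reads `false`; so the value of a wire depends on the stage, and the values at all stages are
recorded. -/
theorem Der.simulate (gs : List Gate) (xs : Ω → List (List Bool)) :
    Der orc inp (inBits xs) (stageBits orc gs xs) (gatesSize gs) := by
  induction gs using List.reverseRecOn with
  | nil =>
    refine of_subset ?_
    rintro _ ⟨⟨w, b⟩, rfl⟩
    cases w with
    | input s i => exact .inl ⟨(s, i), rfl⟩
    | gate i => exact .inr ⟨false, by simp [runGates, Wire.val]⟩
  | append_singleton gs a ih =>
    have mem : ∀ w : Wire, (fun ω => w.val (xs ω) (runGates gs (orc ω) (xs ω))) ∈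
        stageBits orc gs xs := fun w => ⟨(w, gs.length), by
      funext ω; simp only; rw [List.take_of_length_le (by rw [length_runGates])]⟩
    have hlast : Der orc inp (inBits xs ∪ stageBits orc gs xs)
        {fun ω => a.val (orc ω) (xs ω) (runGates gs (orc ω) (xs ω))} a.size := by
      cases a with
      | const b => exact (of_subset (Set.singleton_subset_iff.2 (.inr ⟨b, rfl⟩))).le (Nat.zero_le _)
      | nand w w' => exact nand (.inl (.inr (mem w))) (.inl (.inr (mem w')))
      | hash t args bit =>
        have := hash (orc := orc) (inp := inp) (A := inBits xs ∪ stageBits orc gs xs) t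
          (args.map fun w ω => w.val (xs ω) (runGates gs (orc ω) (xs ω))) (by
            intro f hf
            obtain ⟨w, -, rfl⟩ := List.mem_map.1 hf
            exact .inl (.inr (mem w))) bit
        simp only [List.map_map, List.length_map] at this
        exact this
    have h := (ih.self_union).trans' ((hlast).self_union)
    rw [gatesSize_append]
    refine h.mono Set.subset_union_left ?_ (by simp [gatesSize])
    rintro _ ⟨⟨w, b⟩, rfl⟩
    left
    cases w with
    | input s i => exact .inl (.inl ⟨(s, i), rfl⟩)
    | gate i =>
      -- Only the wire of the new gate, read at a stage beyond `gs.length`, is a new signal. Read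
      -- earlier it gives `false`, as does any later wire, and these signals are in the old set.
      rcases lt_trichotomy i gs.length with hi | rfl | hi
      · refine .inl (.inr ⟨(.gate i, b), ?_⟩)
        funext ω
        simp only [Wire.val, runGates_concat]
        simp only [List.getD_eq_getElem?_getD, List.getElem?_take]
        rw [List.getElem?_append_left (by rwa [length_runGates])]
      · by_cases hb : gs.length < b
        · refine .inr ?_
          simp only [Set.mem_singleton_iff]
          funext ω
          simp only [Wire.val, runGates_concat, List.getD_eq_getElem?_getD, List.getElem?_take]
          rw [if_pos hb, List.getElem?_append_right (by rw [length_runGates]), length_runGates]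
          simp
        · refine .inl (.inr ⟨(.gate gs.length, b), ?_⟩)
          funext ω
          simp [Wire.val, List.getD_eq_getElem?_getD, hb]
      · refine .inl (.inr ⟨(.gate i, b), ?_⟩)
        funext ω
        simp only [Wire.val, List.getD_eq_getElem?_getD, List.getElem?_take]
        rw [List.getElem?_eq_none (by rw [length_runGates]; omega),
          List.getElem?_eq_none (by rw [length_runGates]; simp; omega)]

theorem Circuit.gatesSize_le {m : ℕ} (C : Circuit m) : gatesSize C.gates ≤ C.size :=
  Nat.le_add_right _ _

theorem Circuit.length_out_le {m : ℕ} (C : Circuit m) (k : Fin m) : (C.outs k).length ≤ C.size :=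
  (Finset.single_le_sum (f := fun k => (C.outs k).length) (fun _ _ => Nat.zero_le _)
    (Finset.mem_univ k)).trans (Nat.le_add_left _ _)

theorem strBits_map_wires (gs : List Gate) (ws : List Wire) (xs : Ω → List (List Bool)) (b : ℕ) :
    strBits (fun ω => ws.map (Wire.val (xs ω) ((runGates gs (orc ω) (xs ω)).take b))) ⊆
      stageBits orc gs xs ∪ consts Ω := by
  rintro _ ⟨i, rfl⟩
  rcases lt_or_ge i ws.length with hi | hi
  · refine .inl ⟨(ws[i], b), ?_⟩
    funext ω
    simp [List.getD_eq_getElem?_getD, hi]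
  · exact .inr ⟨false, by funext ω; simp [List.getD_eq_getElem?_getD, hi]⟩

theorem Der.circuit {m : ℕ} (C : Circuit m) {xs : Ω → List (List Bool)}
    (hxs : inBits xs ⊆ A ∪ consts Ω) :
    Der orc inp A (⋃ k, strBits fun ω => C.eval (orc ω) (xs ω) k) C.size := by
  refine (Der.simulate C.gates xs).mono hxs (Set.iUnion_subset fun k => ?_) C.gatesSize_le
  have := strBits_map_wires (orc := orc) C.gates (C.outs k) xs C.gates.length
  refine Set.Subset.trans (le_of_eq ?_) this
  congr 1
  funext ω
  rw [List.take_of_length_le (by rw [length_runGates])]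
  rfl

/-- A derivation of output strings of fixed lengths is a circuit. -/
theorem Der.exists_circuit {m : ℕ} (h : Der orc inp (inBits inp) B s)
    (out : Fin m → Ω → List Bool) (L : Fin m → ℕ) (hL : ∀ k ω, (out k ω).length = L k)
    (hB : ∀ k, strBits (out k) ⊆ B ∪ consts Ω) :
    ∃ C : Circuit m, C.size ≤ s + 2 + ∑ k, L k ∧
      ∀ ω k, C.eval (orc ω) (inp ω) k = out k ω := by
  -- Two leading gates supply the constants; they are the `2` in the size bound.
  have hc : ∀ b, Available orc inp [.const true, .const false] fun _ => b := by
    intro b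
    cases b with
    | false => exact ⟨.gate 1, by simp [Wire.Stable], fun ω => by simp [runGates, Wire.val, Gate.val]⟩
    | true => exact ⟨.gate 0, by simp [Wire.Stable], fun ω => by simp [runGates, Wire.val]; rfl⟩
  obtain ⟨gs, hs, hgs⟩ := h _ hc (by
    rintro _ ⟨⟨s, i⟩, rfl⟩
    exact ⟨.input s i, trivial, fun ω => rfl⟩)
  have hav : ∀ k i, Available orc inp ([.const true, .const false] ++ gs)
      fun ω => (out k ω).getD i false := by
    intro k i
    rcases hB k ⟨i, rfl⟩ with h | ⟨b, h⟩
    · exact hgs _ h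
    · have := (hc b).append gs
      simp only [h] at this
      exact this
  choose w _ hw using hav
  refine ⟨⟨[.const true, .const false] ++ gs, fun k => List.ofFn fun i : Fin (L k) => w k i⟩,
    ?_, fun ω k => ?_⟩
  · have h2 : gatesSize [Gate.const true, Gate.const false] = 2 := by simp [gatesSize, Gate.size]
    have h3 := gatesSize_append [Gate.const true, Gate.const false] gs
    simp only [Circuit.size, List.length_ofFn]
    unfold gatesSize at *
    omega
  · apply List.ext_getElem
    · simp [Circuit.eval, hL]
    · intro i h1 h2
      have : _ = (out k ω).getD i false := hw k i ω
      rw [List.getD_eq_getElem _ _ h2] at this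
      rw [← this]
      simp [Circuit.eval, Circuit.run, runGates]

end Derivation

section Arithmetic

variable {Ω : Type} {orc : Ω → Fin 2 × List Bool → ℕ} {inp : Ω → List (List Bool)}
  {A : Set (Ω → Bool)} {s : ℕ}

/-! ## Circuits for arithmetic modulo a prime -/

/-- The bits of a natural number. -/
def natBits (x : Ω → ℕ) : Set (Ω → Bool) := codeBits Nat.testBit x

/-- The bits of a scalar. -/
def zBits {p : ℕ} (x : Ω → ZMod p) : Set (Ω → Bool) := codeBits (fun x i => x.val.testBit i) x

/-- Square-and-multiply in a monoid with an encoding. -/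
theorem Der.pow {R : Type} [Monoid R] {c : R → ℕ → Bool} (N ℓ : ℕ)
    (hN : ∀ r, ∀ i ≥ N, c r i = false)
    (hmul : ∀ a b : Ω → R, Der orc inp (codeBits c a ∪ codeBits c b)
      (codeBits c fun ω => a ω * b ω) s)
    {a : Ω → R} {x : Ω → ℕ} (hx : ∀ ω, x ω < 2 ^ ℓ)
    (ha : codeBits c a ⊆ A ∪ consts Ω) (hxA : natBits x ⊆ A ∪ consts Ω) :
    Der orc inp A (codeBits c fun ω => a ω ^ x ω) (ℓ * (2 * s + 4 * N)) := by
  -- Loop invariant: after `t` rounds the state is `a` to the number formed by the top `t` of the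
  -- `ℓ` bits of the exponent. A round squares and then multiplies by `a` or by `1`.
  have h := Der.iterate (orc := orc) (inp := inp) (A := A) (s := 2 * s + 4 * N)
    (B := fun t => codeBits c fun ω => a ω ^ (x ω / 2 ^ (ℓ - t))) ℓ (by
    intro t ht
    have h1 := hmul (fun ω => a ω ^ (x ω / 2 ^ (ℓ - t))) fun ω => a ω ^ (x ω / 2 ^ (ℓ - t))
    rw [Set.union_self] at h1
    have h2 := Der.select (orc := orc) (inp := inp) (A := A) (c := c) N hN
      (f := fun ω => (x ω).testBit (ℓ - (t + 1))) (a := a) (b := fun _ => 1)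
      (hxA ⟨_, rfl⟩) ha ((codeBits_const c 1).trans Set.subset_union_right)
    have h3 := ((h1.left (Set.subset_union_right (s := A))).union
      (h2.left Set.subset_union_left)).trans' (hmul _ _)
    refine (h3.right (Set.Subset.trans (le_of_eq ?_) Set.subset_union_left)).le (by omega)
    congr 1
    funext ω
    have e1 : ℓ - t = (ℓ - (t + 1)) + 1 := by omega
    have e2 : x ω / 2 ^ (ℓ - (t + 1)) = 2 * (x ω / 2 ^ (ℓ - t)) +
        ((x ω).testBit (ℓ - (t + 1))).toNat := by
      rw [Nat.toNat_testBit, e1, pow_succ, ← Nat.div_div_eq_div_mul]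
      omega
    rw [e2, pow_add, two_mul, pow_add]
    cases (x ω).testBit (ℓ - (t + 1)) <;> simp)
  refine h.mono (Set.union_subset Set.subset_union_left ?_)
    (by simp) le_rfl
  have : (fun ω => a ω ^ (x ω / 2 ^ (ℓ - 0))) = fun _ => (1 : R) := by
    funext ω
    rw [Nat.sub_zero, Nat.div_eq_of_lt (hx ω), pow_zero]
  simp only [this]
  exact (codeBits_const c 1).trans Set.subset_union_right

/-- The carry bits of an addition. -/
theorem testBit_add (x y i : ℕ) : (x + y).testBit i =
    (x.testBit i ^^ (y.testBit i ^^ decide (2 ^ i ≤ x % 2 ^ i + y % 2 ^ i))) := by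
  have := BitVec.getLsbD_add (w := i + 1) (i := i) (by omega) (BitVec.ofNat (i + 1) x)
    (BitVec.ofNat (i + 1) y)
  rw [← BitVec.ofNat_add] at this
  simpa [BitVec.getLsbD_ofNat, BitVec.carry, Nat.mod_mod_of_dvd, pow_succ, -BitVec.getLsbD_eq_getElem] using this

/-- The recursion of the ripple-carry adder: the next carry is the majority of the two bits and the
present carry. -/
theorem carry_succ (x y i : ℕ) : decide (2 ^ (i + 1) ≤ x % 2 ^ (i + 1) + y % 2 ^ (i + 1)) =
    Bool.atLeastTwo (x.testBit i) (y.testBit i) (decide (2 ^ i ≤ x % 2 ^ i + y % 2 ^ i)) := by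
  have := BitVec.carry_succ i (BitVec.ofNat (i + 1) x) (BitVec.ofNat (i + 1) y) false
  simpa [BitVec.getLsbD_ofNat, BitVec.carry, Nat.mod_mod_of_dvd, pow_succ, -BitVec.getLsbD_eq_getElem] using this

theorem Der.natAdd (ℓ : ℕ) {x y : Ω → ℕ} (hx : ∀ ω, x ω < 2 ^ ℓ) (hy : ∀ ω, y ω < 2 ^ ℓ)
    (hxA : natBits x ⊆ A ∪ consts Ω) (hyA : natBits y ⊆ A ∪ consts Ω) :
    Der orc inp A (natBits fun ω => x ω + y ω) (ℓ * 28 + (ℓ + 1) * 28) := by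
  let c : ℕ → Ω → Bool := fun i ω => decide (2 ^ i ≤ x ω % 2 ^ i + y ω % 2 ^ i)
  -- The state consists of all carries up to `t`, not only the last one, since every bit of the sum
  -- needs its own carry.
  have h := Der.iterate (orc := orc) (inp := inp) (A := A) (s := 28)
    (B := fun t => {f | ∃ i ≤ t, c i = f}) ℓ (by
    intro t ht
    have h1 := (Der.bool₃ (orc := orc) (inp := inp) (A := A ∪ {f | ∃ i ≤ t, c i = f})
      Bool.atLeastTwo (f := fun ω => (x ω).testBit t) (g := fun ω => (y ω).testBit t) (h := c t)
      ((hxA ⟨t, rfl⟩).imp_left Or.inl) ((hyA ⟨t, rfl⟩).imp_left Or.inl)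
      (.inl (.inr ⟨t, le_rfl, rfl⟩))).self_union
    refine h1.right ?_
    rintro _ ⟨i, hi, rfl⟩
    left
    rcases Nat.lt_or_ge t i with hi' | hi'
    · obtain rfl : i = t + 1 := by omega
      right
      simp only [Set.mem_singleton_iff]
      funext ω
      exact carry_succ _ _ _
    · exact .inl (.inr ⟨i, hi', rfl⟩))
  have h' := h.mono (A' := A) (Set.union_subset Set.subset_union_left (by
    rintro _ ⟨i, hi, rfl⟩
    obtain rfl : i = 0 := by omega
    exact .inr ⟨false, by funext ω; simp [c, Nat.mod_one]⟩)) Set.subset_union_left le_rfl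
  refine h'.trans (Der.ofBits (c := Nat.testBit) (ℓ + 1) (fun ω i hi => ?_) fun i hi => ?_)
  · refine Nat.testBit_lt_two_pow (lt_of_lt_of_le ?_ (Nat.pow_le_pow_right two_pos hi))
    rw [pow_succ]
    linarith [hx ω, hy ω]
  · have := Der.bool₃ (orc := orc) (inp := inp) (A := A ∪ {f | ∃ i ≤ ℓ, c i = f})
      (fun a b c => a ^^ (b ^^ c)) (f := fun ω => (x ω).testBit i) (g := fun ω => (y ω).testBit i)
      (h := c i) ((hxA ⟨i, rfl⟩).imp_left Or.inl) ((hyA ⟨i, rfl⟩).imp_left Or.inl)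
      (.inl (.inr ⟨i, by omega, rfl⟩))
    simpa only [testBit_add] using this

variable {p : ℕ}

/-- The cost of an addition modulo `p`. -/
def addCost (ℓ : ℕ) : ℕ := 200 * (ℓ + 2)

theorem zval_testBit [NeZero p] (r : ZMod p) (i : ℕ) (hi : i ≥ Nat.size p) :
    r.val.testBit i = false :=
  Nat.testBit_lt_two_pow ((ZMod.val_lt r).trans (Nat.size_le.1 hi))

/-- Add `2^(ℓ+1) - p` to the integer sum `x + y`. Bit `ℓ + 1` of the result tells whether `x + y ≥
p`, and in that case the low bits are those of `x + y - p`. A multiplexer then chooses between the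
two candidates. -/
theorem Der.zAdd [NeZero p] (x y : Ω → ZMod p) :
    Der orc inp (zBits x ∪ zBits y) (zBits fun ω => x ω + y ω) (addCost (Nat.size p)) := by
  set ℓ := Nat.size p
  have hp : p < 2 ^ ℓ := Nat.lt_size_self p
  have lt : ∀ r : ZMod p, r.val < 2 ^ ℓ := fun r => (ZMod.val_lt r).trans hp
  have h1 := Der.natAdd (orc := orc) (inp := inp) (A := zBits x ∪ zBits y) ℓ
    (x := fun ω => (x ω).val) (y := fun ω => (y ω).val) (fun ω => lt _) (fun ω => lt _)
    (fun f hf => .inl (.inl hf)) (fun f hf => .inl (.inr hf))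
  have e : (2 : ℕ) ^ (ℓ + 1) = 2 * 2 ^ ℓ := by rw [pow_succ]; ring
  have h2 := Der.natAdd (orc := orc) (inp := inp)
    (A := natBits fun ω => (x ω).val + (y ω).val) (ℓ + 1)
    (x := fun ω => (x ω).val + (y ω).val) (y := fun _ => 2 ^ (ℓ + 1) - p)
    (fun ω => by have := lt (x ω); have := lt (y ω); omega)
    (fun ω => by have := NeZero.pos p; omega)
    Set.subset_union_left ((codeBits_const _ _).trans Set.subset_union_right)
  have h3 := h1.trans' (h2.self_union)
  refine (h3.trans' (Der.ofBits (s := 4) ℓ (fun ω i hi => zval_testBit _ _ hi)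
    fun i hi => ?_)).le ?_
  · have := Der.mux (orc := orc) (inp := inp)
      (A := (natBits fun ω => (x ω).val + (y ω).val) ∪
        natBits fun ω => (x ω).val + (y ω).val + (2 ^ (ℓ + 1) - p))
      (c := fun ω => ((x ω).val + (y ω).val + (2 ^ (ℓ + 1) - p)).testBit (ℓ + 1))
      (f := fun ω => ((x ω).val + (y ω).val + (2 ^ (ℓ + 1) - p)).testBit i)
      (g := fun ω => ((x ω).val + (y ω).val).testBit i)
      (.inl (.inr ⟨_, rfl⟩)) (.inl (.inr ⟨_, rfl⟩)) (.inl (.inl ⟨_, rfl⟩))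
    refine this.right (Set.singleton_subset_iff.2 (.inl ?_))
    simp only [Set.mem_singleton_iff]
    funext ω
    have hx := ZMod.val_lt (x ω)
    have hy := ZMod.val_lt (y ω)
    rw [ZMod.val_add]
    by_cases hs : p ≤ (x ω).val + (y ω).val
    · have hd : ((x ω).val + (y ω).val - p).testBit (ℓ + 1) = false :=
        Nat.testBit_lt_two_pow (by omega)
      have ht : (x ω).val + (y ω).val + (2 ^ (ℓ + 1) - p) =
          2 ^ (ℓ + 1) + ((x ω).val + (y ω).val - p) := by omega
      rw [ht, Nat.testBit_two_pow_add_eq, hd, Bool.not_false,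
        if_pos rfl, Nat.testBit_two_pow_add_gt (by omega), Nat.mod_eq_sub_mod hs,
        Nat.mod_eq_of_lt (by omega)]
    · have hd : ((x ω).val + (y ω).val + (2 ^ (ℓ + 1) - p)).testBit (ℓ + 1) = false :=
        Nat.testBit_lt_two_pow (by omega)
      rw [hd, Nat.mod_eq_of_lt (by omega)]
      simp
  · unfold addCost; omega

/-- The cost of a multiplication modulo `p`. -/
def mulCost (ℓ : ℕ) : ℕ := ℓ * (2 * addCost ℓ + 4 * ℓ)

/-- Double-and-add: a product is a power in `Multiplicative (ZMod p)`, so `Der.pow` applies with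
`Der.zAdd` as its multiplication. -/
theorem Der.zMul [NeZero p] (x y : Ω → ZMod p) :
    Der orc inp (zBits x ∪ zBits y) (zBits fun ω => x ω * y ω) (mulCost (Nat.size p)) := by
  have := Der.pow (orc := orc) (inp := inp) (A := zBits x ∪ zBits y) (R := Multiplicative (ZMod p))
    (c := fun x i => x.toAdd.val.testBit i) (Nat.size p) (Nat.size p)
    (fun r i hi => zval_testBit _ _ hi) (fun a b => Der.zAdd (fun ω => (a ω).toAdd) _)
    (a := fun ω => Multiplicative.ofAdd (x ω)) (x := fun ω => (y ω).val)
    (fun ω => (ZMod.val_lt _).trans (Nat.lt_size_self p))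
    (fun f hf => .inl (.inl hf)) (fun f hf => .inl (.inr hf))
  refine this.right (Set.Subset.trans (le_of_eq ?_) Set.subset_union_left)
  unfold zBits codeBits
  congr 1
  funext i ω
  simp [← ofAdd_nsmul, mul_comm]

/-- The cost of a power modulo `p`. -/
def powCost (ℓ : ℕ) : ℕ := ℓ * (2 * mulCost ℓ + 4 * ℓ)

theorem Der.zPow [NeZero p] (x : Ω → ZMod p) (e : ℕ) (he : e < p) :
    Der orc inp (zBits x) (zBits fun ω => x ω ^ e) (powCost (Nat.size p)) :=
  Der.pow (R := ZMod p) (c := fun x i => x.val.testBit i) (Nat.size p) (Nat.size p)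
    (fun _ _ hi => zval_testBit _ _ hi) (fun _ _ => Der.zMul _ _)
    (x := fun _ => e) (fun _ => he.trans (Nat.lt_size_self p))
    Set.subset_union_left ((codeBits_const _ _).trans Set.subset_union_right)

/-- Differences, and inverses of them, modulo a prime. -/
theorem Der.zInvSub [Fact p.Prime] (x y : Ω → ZMod p) (h : ∀ ω, x ω ≠ y ω) :
    Der orc inp (zBits x ∪ zBits y) (zBits fun ω => (x ω - y ω)⁻¹)
      (mulCost (Nat.size p) + addCost (Nat.size p) + powCost (Nat.size p)) := by
  have h1 := Der.zMul (orc := orc) (inp := inp) (fun _ => (-1 : ZMod p)) y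
  have h2 := (h1.mono (A' := zBits x ∪ zBits y)
    (Set.union_subset ((codeBits_const _ _).trans Set.subset_union_right) fun f hf => .inl (.inr hf))
    Set.subset_union_left le_rfl).trans ((Der.zAdd x _).left
      (Set.union_subset_union_left _ Set.subset_union_left))
  -- By Fermat, a nonzero residue has its power with exponent `p - 2` as inverse; `h` makes the
  -- difference nonzero.
  have h3 := h2.trans' (Der.zPow _ (p - 2) (by have := (Fact.out : p.Prime).pos; omega))
  refine h3.right (Set.Subset.trans (le_of_eq ?_) Set.subset_union_left)
  unfold zBits
  congr 1
  funext ω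
  have hne : x ω + -1 * y ω ≠ 0 := by
    rw [neg_one_mul, ← sub_eq_add_neg]; exact sub_ne_zero.2 (h ω)
  have := ZMod.pow_card_sub_one_eq_one hne
  rw [show p - 1 = p - 2 + 1 by have := (Fact.out : p.Prime).two_le; omega, pow_succ] at this
  rw [eq_inv_of_mul_eq_one_left this]
  ring_nf

theorem encScalar_injective [NeZero p] : Function.Injective (encScalar (p := p)) := by
  intro x y h
  refine ZMod.val_injective p (Nat.eq_of_testBit_eq fun i => ?_)
  rcases lt_or_ge i (Nat.size p) with hi | hi
  · have := congrFun (List.ofFn_injective h) ⟨i, hi⟩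
    exact this
  · rw [zval_testBit _ _ hi, zval_testBit _ _ hi]

theorem length_encScalar (x : ZMod p) : (encScalar x).length = Nat.size p := by simp [encScalar]

theorem zBits_eq_strBits [NeZero p] (x : Ω → ZMod p) : zBits x = strBits fun ω => encScalar (x ω) := by
  unfold zBits strBits codeBits
  congr 1
  funext i ω
  dsimp only
  rcases lt_or_ge i (Nat.size p) with hi | hi
  · rw [List.getD_eq_getElem _ _ (by simpa [encScalar] using hi)]
    simp [encScalar]
  · rw [zval_testBit _ _ hi, List.getD_eq_default _ _ (by simpa [encScalar] using hi)]

end Arithmetic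

/-! ## Circuits for the group -/

section GroupPow

variable {G : Type} [CommGroup G] {p : ℕ}

/-- As `a ^ p = 1`, reduction of exponents modulo `p` is harmless. This lemma and the next ones let
exponents be calculated in `ZMod p`. -/
theorem pow_val_add [NeZero p] {a : G} (ha : a ^ p = 1) (x y : ZMod p) :
    a ^ (x + y).val = a ^ x.val * a ^ y.val := by
  rw [ZMod.val_add, ← pow_add, ← pow_mod_orderOf, Nat.mod_mod_of_dvd _ (orderOf_dvd_of_pow_eq_one ha),
    pow_mod_orderOf]

theorem pow_val_mul [NeZero p] {a : G} (ha : a ^ p = 1) (x y : ZMod p) :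
    a ^ (x * y).val = (a ^ x.val) ^ y.val := by
  rw [ZMod.val_mul, ← pow_mul, ← pow_mod_orderOf, Nat.mod_mod_of_dvd _ (orderOf_dvd_of_pow_eq_one ha),
    pow_mod_orderOf]

theorem pow_val_sum [NeZero p] {a : G} (ha : a ^ p = 1) {ι : Type} (s : Finset ι) (x : ι → ZMod p) :
    a ^ (∑ i ∈ s, x i).val = ∏ i ∈ s, a ^ (x i).val := by
  induction s using Finset.cons_induction with
  | empty => simp
  | cons i s hi ih => rw [Finset.sum_cons, Finset.prod_cons, pow_val_add ha, ih]

theorem pow_val_sub [NeZero p] {a : G} (ha : a ^ p = 1) (x y : ZMod p) :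
    a ^ (x - y).val = a ^ x.val / a ^ y.val := by
  rw [eq_div_iff_mul_eq', ← pow_val_add ha]
  congr 2
  ring

/-- The commitment to the polynomial `∑ᵢ yᵢ κᵢ`, where `κᵢ` is given by its coefficients. -/
def lin {d k : ℕ} (srs : Fin (d + 1) → G) (κ : Fin k → Fin (d + 1) → ZMod p)
    (y : Fin k → ZMod p) : G :=
  ∏ i, (∏ m, srs m ^ (κ i m).val) ^ (y i).val

/-- Interchange of two products: committing is linear in the polynomial. Hence, for fixed `q i` and
varying `y i`, the commitment is computed from `srs` with the coefficients of the `q i` hard-wired.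
-/
theorem lin_eq_commit [NeZero p] {d k : ℕ} {srs : Fin (d + 1) → G} (hs : ∀ m, srs m ^ p = 1)
    (q : Fin k → Polynomial (ZMod p)) (y : Fin k → ZMod p) :
    lin srs (fun i m => (q i).coeff m) y = KZG.commit srs (∑ i, Polynomial.C (y i) * q i) := by
  unfold lin KZG.commit
  simp_rw [← Finset.prod_pow]
  rw [Finset.prod_comm]
  refine Finset.prod_congr rfl fun m _ => ?_
  rw [Polynomial.finsetSum_coeff, pow_val_sum (hs m)]
  refine Finset.prod_congr rfl fun i _ => ?_
  rw [← pow_val_mul (hs m), Polynomial.coeff_C_mul, mul_comm]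

end GroupPow

/-- A final `1` is the padding mark and a final `0` is filler. This recursion along prefixes drives
`Der.hash_unpad`. -/
theorem unpad_append_singleton (l : List Bool) (b : Bool) :
    unpad (l ++ [b]) = if b then l else unpad l := by
  cases b <;> simp [unpad]

theorem getD_flatten {L : ℕ} {ls : List (List Bool)} (h : ∀ l ∈ ls, l.length = L) (i b : ℕ)
    (hi : i < ls.length) (hb : b < L) :
    ls.flatten.getD (i * L + b) false = (ls.getD i []).getD b false := by
  induction ls generalizing i with
  | nil => simp at hi
  | cons l ls ih =>
    have hl : l.length = L := h l (by simp)
    rw [List.flatten_cons]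
    cases i with
    | zero =>
      rw [List.getD_append _ _ _ _ (by omega)]
      simp
    | succ i =>
      rw [List.getD_append_right _ _ _ _ (by rw [hl, Nat.succ_mul]; omega), hl]
      rw [show (i + 1) * L + b - L = i * L + b by rw [Nat.succ_mul]; omega]
      rw [ih (fun l hl => h l (by simp [hl])) i (by simpa using hi)]
      simp

section Group

variable (𝔾 : BilinearGroup) {n : ℕ} {Ω : Type} {O : Ω → Fin 2 × List Bool → ZMod (𝔾.p n)}
  {inp : Ω → List (List Bool)} {A : Set (Ω → Bool)} {s : ℕ}

theorem BilinearGroup.pow_p {n : ℕ} (a : 𝔾.G n) : a ^ 𝔾.p n = 1 := by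
  rw [← 𝔾.card_G n]; exact pow_card_eq_one

/-- The oracle with values in `ℕ`. -/
def natOracle {p : ℕ} (O : Ω → Fin 2 × List Bool → ZMod p) : Ω → Fin 2 × List Bool → ℕ :=
  fun ω q => (O ω q).val

/-- The size of the multiplication circuit. -/
def mulSize (n : ℕ) : ℕ := (𝔾.mul_efficient.choose.circuit n).size

/-- The bits of a group element. -/
def gBits (a : Ω → 𝔾.G n) : Set (Ω → Bool) := codeBits (fun a i => (𝔾.enc n a).getD i false) a

theorem enc_getD (r : 𝔾.G n) (i : ℕ) (hi : i ≥ 𝔾.encLen n) : (𝔾.enc n r).getD i false = false :=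
  List.getD_eq_default _ _ (by rwa [𝔾.enc_length])

variable {𝔾}

theorem Der.gMul (a b : Ω → 𝔾.G n) : Der (natOracle O) inp (gBits 𝔾 a ∪ gBits 𝔾 b)
    (gBits 𝔾 fun ω => a ω * b ω) (mulSize 𝔾 n) := by
  have h := Der.circuit (orc := natOracle O) (inp := inp) (A := gBits 𝔾 a ∪ gBits 𝔾 b)
    (𝔾.mul_efficient.choose.circuit n) (xs := fun ω => [𝔾.enc n (a ω), 𝔾.enc n (b ω)])
    (inBits_cons (fun f hf => .inl (.inl hf)) (inBits_cons (fun f hf => .inl (.inr hf))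
      (inBits_nil.trans Set.subset_union_right)))
  refine h.right (Set.Subset.trans ?_ Set.subset_union_left)
  refine Set.Subset.trans (le_of_eq ?_) (Set.subset_iUnion _ (0 : Fin 1))
  unfold gBits strBits codeBits
  congr 1
  funext i ω
  dsimp only
  rw [← 𝔾.mul_efficient.choose_spec n (O ω)]
  rfl

/-- The cost of a power in the group. -/
def gPowCost (𝔾 : BilinearGroup) (n : ℕ) : ℕ :=
  Nat.size (𝔾.p n) * (2 * mulSize 𝔾 n + 4 * 𝔾.encLen n)

theorem Der.gPow {a : Ω → 𝔾.G n} {x : Ω → ZMod (𝔾.p n)} (ha : gBits 𝔾 a ⊆ A ∪ consts Ω)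
    (hx : zBits x ⊆ A ∪ consts Ω) :
    Der (natOracle O) inp A (gBits 𝔾 fun ω => a ω ^ (x ω).val) (gPowCost 𝔾 n) :=
  Der.pow _ _ (enc_getD 𝔾) Der.gMul
    (fun _ => (ZMod.val_lt _).trans (Nat.lt_size_self _)) ha hx

theorem Der.gProd {k : ℕ} {a : Fin k → Ω → 𝔾.G n}
    (h : ∀ i, Der (natOracle O) inp A (gBits 𝔾 (a i)) s) :
    Der (natOracle O) inp A (gBits 𝔾 fun ω => ∏ i, a i ω) (k * (s + mulSize 𝔾 n)) := by
  induction k with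
  | zero =>
    simp only [Finset.univ_eq_empty, Finset.prod_empty]
    exact (Der.of_subset ((codeBits_const _ _).trans Set.subset_union_right)).le (Nat.zero_le _)
  | succ k ih =>
    simp only [Fin.prod_univ_castSucc]
    refine (((ih fun i => h i.castSucc).union (h (Fin.last k))).trans' (Der.gMul _ _)).le ?_
    rw [Nat.succ_mul]
    omega

theorem gBits_subset_encSrs {d : ℕ} (srs : Ω → Fin (d + 1) → 𝔾.G n) (m : Fin (d + 1)) :
    gBits 𝔾 (fun ω => srs ω m) ⊆ strBits (fun ω => encSrs 𝔾 n (srs ω)) ∪ consts Ω := by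
  rintro _ ⟨b, rfl⟩
  rcases lt_or_ge b (𝔾.encLen n) with hb | hb
  · refine .inl ⟨m * 𝔾.encLen n + b, ?_⟩
    funext ω
    dsimp only
    rw [encSrs, getD_flatten (by simp [𝔾.enc_length]) m b
      (by rw [List.length_ofFn]; exact m.2) hb, List.getD_eq_getElem (l := List.ofFn _) _ (by rw [List.length_ofFn]; exact m.2), List.getElem_ofFn]
  · exact .inr ⟨false, by funext ω; simp only [enc_getD 𝔾 _ b hb]⟩

/-- The cost of a linear combination in the exponent. -/
def linCost (𝔾 : BilinearGroup) (k d n : ℕ) : ℕ :=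
  k * ((d + 1) * (gPowCost 𝔾 n + mulSize 𝔾 n) + gPowCost 𝔾 n + mulSize 𝔾 n)

theorem Der.lin {d k : ℕ} (srs : Ω → Fin (d + 1) → 𝔾.G n) (κ : Fin k → Fin (d + 1) → ZMod (𝔾.p n))
    (y : Ω → Fin k → ZMod (𝔾.p n)) (hs : strBits (fun ω => encSrs 𝔾 n (srs ω)) ⊆ A ∪ consts Ω)
    (hy : ∀ i, zBits (fun ω => y ω i) ⊆ A ∪ consts Ω) :
    Der (natOracle O) inp A (gBits 𝔾 fun ω => PoE.lin (srs ω) κ (y ω)) (linCost 𝔾 k d n) := by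
  refine Der.gProd fun i => ?_
  have h1 : Der (natOracle O) inp A (gBits 𝔾 fun ω => ∏ m, srs ω m ^ (κ i m).val)
      ((d + 1) * (gPowCost 𝔾 n + mulSize 𝔾 n)) :=
    Der.gProd fun m => Der.gPow (x := fun _ => κ i m)
      ((gBits_subset_encSrs srs m).trans (Set.union_subset hs Set.subset_union_right))
      ((codeBits_const _ _).trans Set.subset_union_right)
  exact h1.trans (Der.gPow (fun f hf => .inl (.inr hf)) fun f hf => (hy i hf).imp_left Or.inl)

/-- The cost of hashing a padded string of length at most `m`. -/
def hashCost (ℓ m : ℕ) : ℕ := ℓ * (1 + m * (m + 1 + 4))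

/-- The length of `unpad (y ω)` depends on `ω`, while a hash gate has a fixed number of arguments.
So all prefixes of `y ω` are hashed, and a chain of multiplexers selects the prefix that ends just
before the last `1`. -/
theorem Der.hash_unpad {p : ℕ} [NeZero p] {O : Ω → Fin 2 × List Bool → ZMod p}
    (t : Fin 2) (y : Ω → List Bool) (m : ℕ) (hm : ∀ ω, (y ω).length = m) :
    Der (natOracle O) inp (strBits y) (zBits fun ω => O ω (t, unpad (y ω)))
      (hashCost (Nat.size p) m) := by
  refine Der.ofBits _ (fun ω => zval_testBit _) fun i _ => ?_
  have hstr : ∀ t' ≤ m, Der (natOracle O) inp (strBits y)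
      {fun ω => (O ω (t, (y ω).take t')).val.testBit i} (t' + 1) := by
    intro t' ht'
    have := Der.hash (orc := natOracle O) (inp := inp) (A := strBits y) t
      ((List.range t').map fun l ω => (y ω).getD l false) (by
        intro f hf
        obtain ⟨l, -, rfl⟩ := List.mem_map.1 hf
        exact .inl ⟨l, rfl⟩) i
    have e : ∀ ω, ((List.range t').map fun l ω => (y ω).getD l false).map (fun f => f ω) =
        (y ω).take t' := by
      intro ω
      apply List.ext_getElem
      · simp [hm, ht']
      · intro j h1 h2
        have : j < (y ω).length := by simp at h2; omega
        simp [this]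
    simp only [e] at this
    simp only [List.length_map, List.length_range] at this
    exact this
  have h := Der.iterate (orc := natOracle O) (inp := inp) (A := strBits y) (s := m + 1 + 4)
    (B := fun t' => {fun ω => (O ω (t, unpad ((y ω).take t'))).val.testBit i}) m (by
    intro t' ht'
    have h1 := ((hstr t' ht'.le).left (Set.subset_union_left (t :=
      {fun ω => (O ω (t, unpad ((y ω).take t'))).val.testBit i}))).trans
      (Der.mux (c := fun ω => (y ω).getD t' false)
        (f := fun ω => (O ω (t, (y ω).take t')).val.testBit i)
        (g := fun ω => (O ω (t, unpad ((y ω).take t'))).val.testBit i)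
        (.inl (.inl (.inl ⟨t', rfl⟩))) (.inl (.inr rfl)) (.inl (.inl (.inr rfl))))
    refine (h1.right (Set.singleton_subset_iff.2 (.inl ?_))).le (by omega)
    simp only [Set.mem_singleton_iff]
    funext ω
    have hl : t' < (y ω).length := by rw [hm]; exact ht'
    rw [← List.take_append_getElem hl, unpad_append_singleton, List.getD_eq_getElem _ _ hl]
    split_ifs <;> rfl)
  have h0 := (hstr 0 (Nat.zero_le _)).right (B' := {fun ω => (O ω (t, unpad ((y ω).take 0))).val.testBit i})
    (by simp [unpad])
  refine (h0.trans h).right (Set.singleton_subset_iff.2 (.inl ?_)) |>.le (by omega)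
  simp only [Set.mem_singleton_iff]
  funext ω
  rw [List.take_of_length_le (by rw [hm])]

end Group

/-! ## Circuits for the game -/

section Game

variable {𝔾 : BilinearGroup} {S : Snark} (D : ℕ → ℕ) {k : ℕ → ℕ} {B : Builder k} {n : ℕ} {Ω : Type}
  (O : Ω → Fin 2 × List Bool → ZMod (𝔾.p n)) {inp : Ω → List (List Bool)}
  (h : Ω → History 𝔾 S B n)

/-- The Lagrange basis does not depend on the data, so its coefficients are constants of the circuit
and only the hashes of the parts vary. -/
theorem hiddenState_eq_lin (O : Fin 2 × List Bool → ZMod (𝔾.p n)) (ω : History 𝔾 S B n) :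
    hiddenState 𝔾 S D B O ω = lin (srs 𝔾 S D B ω)
      (fun i m => (Lagrange.basis Finset.univ
        (fun j : Fin (k n) => ((j : ℕ) : ZMod (𝔾.p n))) i).coeff m)
      fun j => O (0, part 𝔾 S D B O ω j) := by
  rw [lin_eq_commit fun m => 𝔾.pow_p _]
  rfl

/-- The bits of the public parameters. -/
def paramBits : Set (Ω → Bool) :=
  strBits (fun ω => encSrs 𝔾 n (srs 𝔾 S D B (h ω))) ∪
    (strBits (fun ω => provingKey 𝔾 S B (O ω) (h ω)) ∪
      strBits fun ω => verificationKey 𝔾 S B (O ω) (h ω))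

theorem strBits_const (y : List Bool) : strBits (fun _ : Ω => y) ⊆ consts Ω := codeBits_const _ _

/-- The coins of `store` have a fixed value `σ`, so their bits are constants that can be hard-wired.
-/
theorem Der.store (σ : Fin (B.store.coins n) → Bool) (hσ : ∀ ω, (h ω).2.2.2 = σ) :
    Der (natOracle O) inp (paramBits D O h)
      (⋃ j, strBits fun ω => B.store.out n (O ω) (publicParams 𝔾 S D B (O ω) (h ω)) (h ω).2.2.2 j)
      (B.store.circuit n).size := by
  refine Der.circuit (orc := natOracle O) (B.store.circuit n)
    (xs := fun ω => publicParams 𝔾 S D B (O ω) (h ω) ++ [List.ofFn (h ω).2.2.2]) ?_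
  simp only [hσ]
  exact inBits_cons (fun f hf => .inl (.inl hf)) (inBits_cons (fun f hf => .inl (.inr (.inl hf)))
    (inBits_cons (fun f hf => .inl (.inr (.inr hf)))
      (inBits_cons ((strBits_const _).trans Set.subset_union_right)
        (inBits_nil.trans Set.subset_union_right))))

/-- The bits of the hashes of the parts. -/
def partHashBits : Set (Ω → Bool) :=
  ⋃ j, zBits fun ω => O ω (0, part 𝔾 S D B (O ω) (h ω) j)

/-- The cost of the game up to the deletion. -/
def storeCost (𝔾 : BilinearGroup) (D : ℕ → ℕ) (B : Builder k) (n : ℕ) : ℕ :=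
  (B.store.circuit n).size + (k n * hashCost (Nat.size (𝔾.p n)) (B.store.circuit n).size +
    linCost 𝔾 (k n) (D n) n)

theorem hashCost_mono (ℓ : ℕ) {m m' : ℕ} (h : m ≤ m') : hashCost ℓ m ≤ hashCost ℓ m' := by
  unfold hashCost
  gcongr

/-- Run `store`, hash the parts, and form the hidden state from `srs` and these hashes. The hashes
are kept because the strong Diffie–Hellman reduction needs the true values of the batch polynomial.
-/
theorem Der.view (σ : Fin (B.store.coins n) → Bool) (hσ : ∀ ω, (h ω).2.2.2 = σ) :
    Der (natOracle O) inp (paramBits D O h)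
      (partHashBits D O h ∪ inBits fun ω => view 𝔾 S D B (O ω) (h ω))
      (storeCost 𝔾 D B n) := by
  have h1 := (Der.store (inp := inp) D O h σ hσ).self_union
  have h2 : Der (natOracle O) inp
      (⋃ j, strBits fun ω => B.store.out n (O ω) (publicParams 𝔾 S D B (O ω) (h ω)) (h ω).2.2.2 j)
      (partHashBits D O h)
      (k n * hashCost (Nat.size (𝔾.p n)) (B.store.circuit n).size) := by
    refine Der.iUnion_fin fun j => ?_
    refine (((Der.hash_unpad 0 (fun ω => B.store.out n (O ω) (publicParams 𝔾 S D B (O ω) (h ω))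
      (h ω).2.2.2 j.castSucc) ((B.store.circuit n).outs j.castSucc).length fun ω => ?_)).left
      (fun f hf => Set.mem_iUnion.2 ⟨j.castSucc, hf⟩)).le ?_
    · simp [Algorithm.out, DetAlgorithm.out, Circuit.eval]
    · exact hashCost_mono _ (Circuit.length_out_le _ _)
  have h4 : Der (natOracle O) inp (paramBits D O h ∪ partHashBits D O h)
      (gBits 𝔾 fun ω => hiddenState 𝔾 S D B (O ω) (h ω)) (linCost 𝔾 (k n) (D n) n) := by
    simp only [hiddenState_eq_lin]
    exact Der.lin (fun ω => srs 𝔾 S D B (h ω)) _ _ (fun f hf => .inl (.inl (.inl hf)))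
      fun i f hf => .inl (.inr (Set.mem_iUnion.2 ⟨i, hf⟩))
  have h5 := h1.trans' ((h2.left Set.subset_union_right).self_union.trans'
    (h4.left (by
      rintro f (hf | hf)
      · exact .inl (.inl hf)
      · exact .inr hf)).self_union)
  refine h5.right (Set.union_subset (fun f hf => .inl (.inl (.inr hf))) ?_)
  refine inBits_cons (fun f hf => .inl (.inl (.inl (.inl (.inl hf)))))
    (inBits_cons (fun f hf => .inl (.inl (.inl (.inl (.inr (.inl hf))))))
    (inBits_cons (fun f hf => .inl (.inl (.inl (.inl (.inr (.inr hf))))))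
      (inBits_cons (fun f hf => .inl (.inr hf)) (inBits_cons ?_
        (inBits_nil.trans Set.subset_union_right)))))
  exact fun f hf => .inl (.inl (.inl (.inr (Set.mem_iUnion.2 ⟨Fin.last (k n), hf⟩))))

/-- The bits of the response to a challenge. -/
def responseBits (c : List Bool) (ρ : Fin (B.respond.coins n) → Bool) : Set (Ω → Bool) :=
  ⋃ i, strBits fun ω => B.respond.out n (O ω) (view 𝔾 S D B (O ω) (h ω) ++ [c]) ρ i

theorem inBits_view_append {A : Set (Ω → Bool)} (c : List Bool) (ρ : List Bool)
    (hA : inBits (fun ω => view 𝔾 S D B (O ω) (h ω)) ⊆ A ∪ consts Ω) :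
    inBits (fun ω => view 𝔾 S D B (O ω) (h ω) ++ [c] ++ [ρ]) ⊆ A ∪ consts Ω := by
  have hlen : ∀ ω, (view 𝔾 S D B (O ω) (h ω)).length = 5 := fun ω => rfl
  rintro _ ⟨⟨s, i⟩, rfl⟩
  rcases lt_or_ge s 5 with hs | hs
  · refine hA ⟨(s, i), ?_⟩
    funext ω
    dsimp only
    rw [List.append_assoc, List.getD_append _ _ _ _ (by rwa [hlen])]
  · refine .inr ⟨([c, ρ].getD (s - 5) []).getD i false, ?_⟩
    funext ω
    dsimp only
    rw [List.append_assoc, List.getD_append_right _ _ _ _ (by rwa [hlen]), hlen]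
    rfl

theorem Der.response (σ : Fin (B.store.coins n) → Bool) (hσ : ∀ ω, (h ω).2.2.2 = σ)
    (c : List Bool) (ρ : Fin (B.respond.coins n) → Bool) :
    Der (natOracle O) inp (paramBits D O h)
      (partHashBits D O h ∪ responseBits D O h c ρ)
      (storeCost 𝔾 D B n + (B.respond.circuit n).size) := by
  have h1 := Der.view (inp := inp) D O h σ hσ
  have h2 := Der.circuit (orc := natOracle O) (inp := inp) (B.respond.circuit n)
    (inBits_view_append (A := partHashBits D O h ∪ inBits fun ω => PoE.view 𝔾 S D B (O ω) (h ω)) D O h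
      c (List.ofFn ρ) fun f hf => .inl (.inr hf))
  refine (h1.trans' h2.self_union).right ?_
  rintro f (hf | hf)
  · exact .inl (.inl (.inl hf))
  · exact .inl (.inr hf)

end Game

/-! ## Finitely determined events of the random oracle -/

section Resample

open MeasureTheory

variable {p : ℕ}

/-- The event `E` depends only on the values of the oracle at finitely many points. -/
def FinitelyDetermined (E : Set (Fin 2 × List Bool → ZMod p)) : Prop :=
  ∃ T : Finset (Fin 2 × List Bool), ∀ O O', (∀ i ∈ T, O i = O' i) → O ∈ E → O' ∈ E

/-- The extension of a finite table by zero. -/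
def extend (T : Finset (Fin 2 × List Bool)) (a : T → ZMod p) : Fin 2 × List Bool → ZMod p :=
  fun i => if h : i ∈ T then a ⟨i, h⟩ else 0

theorem eq_preimage_restrict {E : Set (Fin 2 × List Bool → ZMod p)}
    {T : Finset (Fin 2 × List Bool)} (hT : ∀ O O', (∀ i ∈ T, O i = O' i) → O ∈ E → O' ∈ E) :
    E = T.restrict ⁻¹' {a | extend T a ∈ E} := by
  ext O
  have h : ∀ i ∈ T, O i = extend T (T.restrict O) i := fun i hi => by simp [extend, hi]
  exact ⟨fun hO => hT _ _ h hO, fun hO => hT _ _ (fun i hi => (h i hi).symm) hO⟩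

variable [Fact p.Prime]

theorem FinitelyDetermined.measurableSet {E : Set (Fin 2 × List Bool → ZMod p)}
    (hE : FinitelyDetermined E) : MeasurableSet E := by
  obtain ⟨T, hT⟩ := hE
  rw [eq_preimage_restrict hT]
  exact (Finset.measurable_restrict T) (Set.toFinite _).measurableSet

/-- The restriction of the oracle to the finite set `T` is uniform among the `p ^ T.card` tables, so
probabilities become counting. -/
theorem real_eq_card_div {E : Set (Fin 2 × List Bool → ZMod p)}
    {T : Finset (Fin 2 × List Bool)} (hT : ∀ O O', (∀ i ∈ T, O i = O' i) → O ∈ E → O' ∈ E) :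
    (randomOracle p).real E = Nat.card {a | extend T a ∈ E} / (p : ℝ) ^ T.card := by
  classical
  have hm : MeasurableSet {a | extend T a ∈ E} := (Set.toFinite _).measurableSet
  rw [eq_preimage_restrict hT, randomOracle, ← map_measureReal_apply (Finset.measurable_restrict T) hm,
    Measure.infinitePi_map_restrict]
  have h : ∀ a : T → ZMod p, (Measure.pi fun _ : T =>
      (PMF.uniformOfFintype (ZMod p)).toMeasure).real {a} = ((p : ℝ) ^ T.card)⁻¹ := by
    intro a
    rw [measureReal_def, Measure.pi_singleton]
    simp [ZMod.card]
  have h2 := sum_measureReal_singleton (μ := Measure.pi fun _ : T =>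
      (PMF.uniformOfFintype (ZMod p)).toMeasure) (Set.toFinite {a | extend T a ∈ E}).toFinset
  rw [Set.Finite.coe_toFinset] at h2
  rw [← eq_preimage_restrict hT, ← h2, Finset.sum_congr rfl fun a _ => h a, Finset.sum_const,
    nsmul_eq_mul, ← Set.ncard_eq_toFinset_card, div_eq_mul_inv]
  rfl

/-- An event is unlikely if it is destroyed by every change of the value of the oracle at a point
that does not depend on this value. -/
theorem real_le_inv_of_update {E : Set (Fin 2 × List Bool → ZMod p)} (hE : FinitelyDetermined E)
    (q : (Fin 2 × List Bool → ZMod p) → Fin 2 × List Bool)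
    (h₁ : ∀ O ∈ E, ∀ y, q (Function.update O (q O) y) = q O)
    (h₂ : ∀ O ∈ E, ∀ y, Function.update O (q O) y ∈ E → y = O (q O)) :
    (randomOracle p).real E ≤ (p : ℝ)⁻¹ := by
  classical
  obtain ⟨T, hT⟩ := hE
  -- A value outside `T` can be changed without leaving `E`, against `h₂`.
  have hqT : ∀ O ∈ E, q O ∈ T := by
    intro O hO
    by_contra hq
    have := h₂ O hO (O (q O) + 1) (hT O _ (fun i hi => by
      rw [Function.update_of_ne (by rintro rfl; exact hq hi)]) hO)
    simp at this
  have hp : (0 : ℝ) < p := by exact_mod_cast (Fact.out : p.Prime).pos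
  rw [real_eq_card_div hT, div_le_iff₀ (by positivity), ← div_eq_inv_mul, le_div_iff₀ hp]
  -- Resampling the value at `q` sends `E × ZMod p` to tables on `T`. It is injective: by `h₁` the
  -- point `q` can be read off the new table, and by `h₂` only one old value puts the table in `E`.
  -- So `p` times the size of `E` is at most the number of tables.
  let F : {a | extend T a ∈ E} × ZMod p → (T → ZMod p) := fun x =>
    T.restrict (Function.update (extend T x.1.1) (q (extend T x.1.1)) x.2)
  have hF : Function.Injective F := by
    rintro ⟨⟨a₁, ha₁⟩, y₁⟩ ⟨⟨a₂, ha₂⟩, y₂⟩ h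
    have he : Function.update (extend T a₁) (q (extend T a₁)) y₁ =
        Function.update (extend T a₂) (q (extend T a₂)) y₂ := by
      funext i
      by_cases hi : i ∈ T
      · exact congrFun h ⟨i, hi⟩
      · rw [Function.update_of_ne (by rintro rfl; exact hi (hqT _ ha₁)),
          Function.update_of_ne (by rintro rfl; exact hi (hqT _ ha₂))]
        simp [extend, hi]
    have hq : q (extend T a₁) = q (extend T a₂) := by
      rw [← h₁ _ ha₁ y₁, he, h₁ _ ha₂ y₂]
    rw [← hq] at he
    have hy : y₁ = y₂ := by simpa using congrFun he (q (extend T a₁))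
    have he' : Function.update (extend T a₁) (q (extend T a₁)) (extend T a₂ (q (extend T a₁))) =
        extend T a₂ := by
      funext i
      by_cases hi : i = q (extend T a₁)
      · subst hi; simp
      · have := congrFun he i
        simpa [hi] using this
    have h3 := h₂ _ ha₁ _ (by rw [he']; exact ha₂)
    rw [h3, Function.update_eq_self] at he'
    have ha : a₁ = a₂ := by
      funext i
      have := congrFun he' i
      simpa [extend] using this
    subst ha hy
    rfl
  have hc := Nat.card_le_card_of_injective F hF
  rw [Nat.card_prod, Nat.card_fun] at hc
  simp only [Nat.card_zmod, Nat.card_eq_fintype_card (α := T), Fintype.card_coe] at hc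
  exact_mod_cast hc

/-- An object that does not depend on `c` agrees with `c` in one case on the average. -/
theorem sum_real_le_one {C : Type} [Fintype C] (E : C → Set (Fin 2 × List Bool → ZMod p))
    (hE : ∀ c, FinitelyDetermined (E c)) (hd : ∀ c c' O, O ∈ E c → O ∈ E c' → c = c') :
    ∑ c, (randomOracle p).real (E c) ≤ 1 := by
  have := sum_measureReal_le_measureReal_univ (μ := randomOracle p) (s := Finset.univ) (t := E)
    (fun c _ => (hE c).measurableSet) (fun c _ c' _ hc => Set.disjoint_left.2 fun O h h' =>
      hc (hd c c' O h h'))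
  simpa using this

end Resample

/-! ## Adaptive queries to the oracle -/

/-- A computation that queries the oracle. -/
inductive QTree (p : ℕ) (α : Type) where
  | pure (a : α)
  | query (i : Fin 2 × List Bool) (k : ZMod p → QTree p α)

namespace QTree

variable {p : ℕ} {α β : Type}

/-- The result of a computation. -/
def run (O : Fin 2 × List Bool → ZMod p) : QTree p α → α
  | pure a => a
  | query i k => (k (O i)).run O

/-- The queries of a computation, in order. -/
def queries (O : Fin 2 × List Bool → ZMod p) : QTree p α → List (Fin 2 × List Bool)
  | pure _ => []
  | query i k => i :: (k (O i)).queries O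

/-- Sequential composition. -/
def bind : QTree p α → (α → QTree p β) → QTree p β
  | pure a, f => f a
  | query i k, f => query i fun z => (k z).bind f

@[simp]
theorem run_bind (O : Fin 2 × List Bool → ZMod p) (t : QTree p α) (f : α → QTree p β) :
    (t.bind f).run O = (f (t.run O)).run O := by
  induction t with
  | pure a => rfl
  | query i k ih => exact ih (O i)

@[simp]
theorem queries_bind (O : Fin 2 × List Bool → ZMod p) (t : QTree p α) (f : α → QTree p β) :
    (t.bind f).queries O = t.queries O ++ (f (t.run O)).queries O := by
  induction t with
  | pure a => rfl
  | query i k ih => simp only [bind, queries, ih (O i)]; rfl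

/-- The queries until the first change of the oracle are not affected. -/
theorem queries_take {O O' : Fin 2 × List Bool → ZMod p} (t : QTree p α) (b : ℕ)
    (h : ∀ i ∈ (t.queries O).take b, O i = O' i) :
    (t.queries O').take (b + 1) = (t.queries O).take (b + 1) := by
  induction t generalizing b with
  | pure a => rfl
  | query i k ih =>
    simp only [queries, List.take_succ_cons]
    cases b with
    | zero => simp
    | succ b =>
      simp only [queries, List.take_succ_cons, List.mem_cons, forall_eq_or_imp] at h
      rw [← h.1, ih (O i) b h.2]

theorem queries_congr {O O' : Fin 2 × List Bool → ZMod p} (t : QTree p α)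
    (h : ∀ i ∈ t.queries O, O i = O' i) : t.queries O' = t.queries O := by
  induction t with
  | pure a => rfl
  | query i k ih =>
    simp only [queries, List.mem_cons, forall_eq_or_imp] at h ⊢
    rw [← h.1, ih (O i) h.2]

theorem run_congr {O O' : Fin 2 × List Bool → ZMod p} (t : QTree p α)
    (h : ∀ i ∈ t.queries O, O i = O' i) : t.run O' = t.run O := by
  induction t with
  | pure a => rfl
  | query i k ih =>
    simp only [queries, List.mem_cons, forall_eq_or_imp] at h
    simp only [run]
    rw [← h.1, ih (O i) h.2]

/-- A query has only `p` possible answers, so the tree branches finitely and contains finitely many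
points. -/
theorem exists_support [NeZero p] (t : QTree p α) :
    ∃ T : Finset (Fin 2 × List Bool), ∀ O, ∀ i ∈ t.queries O, i ∈ T := by
  classical
  induction t with
  | pure a => exact ⟨∅, by simp [queries]⟩
  | query i k ih =>
    choose T hT using ih
    refine ⟨insert i (Finset.univ.biUnion T), fun O j hj => ?_⟩
    simp only [queries, List.mem_cons] at hj
    rcases hj with rfl | hj
    · simp
    · exact Finset.mem_insert_of_mem (Finset.mem_biUnion.2 ⟨O i, Finset.mem_univ _, hT _ O j hj⟩)

/-- An event about the queries of a computation and the answers. -/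
theorem finitelyDetermined [NeZero p] (t : QTree p α) (P : α → List (Fin 2 × List Bool × ZMod p) → Prop) :
    FinitelyDetermined {O | P (t.run O) ((t.queries O).map fun i => (i.1, i.2, O i))} := by
  obtain ⟨T, hT⟩ := t.exists_support
  refine ⟨T, fun O O' h hO => ?_⟩
  have h' : ∀ i ∈ t.queries O, O i = O' i := fun i hi => h i (hT O i hi)
  rw [Set.mem_ofPred_eq, t.run_congr h', t.queries_congr h',
    List.map_congr_left (g := fun i => (i.1, i.2, O i)) fun i hi => by rw [h' i hi]]
  exact hO

/-- The birthday bound: adaptive queries hardly ever find a collision. -/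
theorem real_collision_le [Fact p.Prime] (t : QTree p α) (L : ℕ)
    (hL : ∀ O, (t.queries O).length ≤ L) :
    (randomOracle p).real {O | ∃ i ∈ t.queries O, ∃ j ∈ t.queries O, i ≠ j ∧ O i = O j} ≤
      (L * L : ℕ) * (p : ℝ)⁻¹ := by
  -- `x` names the positions of the two colliding queries. The later one is required to be new at
  -- its position, so that its answer can be resampled.
  let E : Fin L × Fin L → Set (Fin 2 × List Bool → ZMod p) := fun x =>
    {O | ∃ i j, (t.queries O)[x.1.1]? = some i ∧ (t.queries O)[x.2.1]? = some j ∧ x.1 < x.2 ∧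
      j ∉ (t.queries O).take x.2.1 ∧ O i = O j}
  have hsub : {O | ∃ i ∈ t.queries O, ∃ j ∈ t.queries O, i ≠ j ∧ O i = O j} ⊆ ⋃ x, E x := by
    rintro O ⟨i, hi, j, hj, hij, h⟩
    wlog hlt : (t.queries O).idxOf i < (t.queries O).idxOf j generalizing i j
    · refine this j hj i hi hij.symm h.symm (lt_of_le_of_ne (not_lt.1 hlt) fun he => ?_)
      exact hij ((List.idxOf_inj hj).1 he).symm
    have hi' := List.idxOf_lt_length_iff.2 hi
    have hj' := List.idxOf_lt_length_iff.2 hj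
    refine Set.mem_iUnion.2 ⟨(⟨_, hi'.trans_le (hL O)⟩, ⟨_, hj'.trans_le (hL O)⟩), i, j, ?_, ?_,
      hlt, ?_, h⟩
    · simp [List.getElem?_eq_getElem hi']
    · simp [List.getElem?_eq_getElem hj']
    · intro hmem
      obtain ⟨m, hm, he⟩ := List.mem_take_iff_getElem.1 hmem
      have h1 : m < (t.queries O).idxOf j := (lt_min_iff.1 hm).1
      simpa [he] using List.not_of_lt_findIdx (p := (· == j)) (xs := t.queries O) h1
  have hE : ∀ x, (randomOracle p).real (E x) ≤ (p : ℝ)⁻¹ := by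
    intro x
    -- Another answer to the fresh query affects only the queries after it; both points stay where
    -- they are, and a single answer produces the collision.
    have key : ∀ O ∈ E x, ∀ y, ∀ j, (t.queries O)[x.2.1]? = some j →
        (t.queries (Function.update O j y)).take (x.2.1 + 1) = (t.queries O).take (x.2.1 + 1) := by
      rintro O ⟨i, j, hi, hj, hlt, hfresh, h⟩ y j' hj'
      obtain rfl : j = j' := by rw [hj] at hj'; simpa using hj'
      refine t.queries_take _ fun l hl => ?_
      rw [Function.update_of_ne (by rintro rfl; exact hfresh hl)]
    have get : ∀ (l l' : List (Fin 2 × List Bool)) (b m : ℕ), l.take (b + 1) = l'.take (b + 1) →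
        m ≤ b → l[m]? = l'[m]? := by
      intro l l' b m h hm
      have := congrArg (fun l => l[m]?) h
      simpa [List.getElem?_take, Nat.lt_succ_iff.2 hm] using this
    refine real_le_inv_of_update ?_ (fun O => ((t.queries O)[x.2.1]?).getD (0, [])) ?_ ?_
    · refine Eq.mp ?_ (t.finitelyDetermined fun _ l => ∃ i j, l[x.1.1]? = some i ∧
        l[x.2.1]? = some j ∧ x.1 < x.2 ∧ (j.1, j.2.1) ∉ (l.take x.2.1).map (fun i => (i.1, i.2.1)) ∧
          i.2.2 = j.2.2)
      congr 1
      ext O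
      constructor
      · rintro ⟨i, j, hi, hj, hlt, hf, h⟩
        simp only [List.getElem?_map, Option.map_eq_some_iff] at hi hj
        obtain ⟨i, hi, rfl⟩ := hi
        obtain ⟨j, hj, rfl⟩ := hj
        refine ⟨i, j, hi, hj, hlt, ?_, h⟩
        intro hmem
        apply hf
        simpa [← List.map_take] using hmem
      · rintro ⟨i, j, hi, hj, hlt, hf, h⟩
        refine ⟨(i.1, i.2, O i), (j.1, j.2, O j), by simp [hi], by simp [hj], hlt, ?_, h⟩
        intro hmem
        apply hf
        simpa [← List.map_take] using hmem
    · intro O hO y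
      obtain ⟨i, j, hi, hj, hlt, hfresh, h⟩ := id hO
      simp only [hj, Option.getD_some]
      rw [get _ _ _ _ (key O hO y j hj) le_rfl, hj, Option.getD_some]
    · intro O hO y hO'
      obtain ⟨i, j, hi, hj, hlt, hfresh, h⟩ := id hO
      simp only [hj, Option.getD_some] at hO' ⊢
      obtain ⟨i', j', hi', hj', -, -, h'⟩ := hO'
      rw [get _ _ _ _ (key O hO y j hj) le_rfl, hj] at hj'
      rw [get _ _ _ _ (key O hO y j hj) (le_of_lt hlt), hi] at hi'
      simp only [Option.some.injEq] at hi' hj'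
      subst hi' hj'
      have hne : i ≠ j := by
        rintro rfl
        refine hfresh (List.mem_take_iff_getElem.2 ?_)
        obtain ⟨hm, he⟩ := List.getElem?_eq_some_iff.1 hi
        exact ⟨x.1.1, by have : x.1.1 < x.2.1 := hlt; omega, he⟩
      rw [Function.update_self, Function.update_of_ne hne, h] at h'
      exact h'.symm
  calc _ ≤ (randomOracle p).real (⋃ x, E x) := MeasureTheory.measureReal_mono hsub
    _ ≤ ∑ x, (randomOracle p).real (E x) := MeasureTheory.measureReal_iUnion_fintype_le _
    _ ≤ ∑ _x : Fin L × Fin L, (p : ℝ)⁻¹ := Finset.sum_le_sum fun x _ => hE x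
    _ = _ := by simp

/-- A value of the oracle that a computation has not queried cannot be predicted. -/
theorem real_predict_le [Fact p.Prime] (t : QTree p α) (q : α → Fin 2 × List Bool)
    (P : α → ZMod p → Prop) (hP : ∀ a y y', P a y → P a y' → y = y') :
    (randomOracle p).real {O | q (t.run O) ∉ t.queries O ∧ P (t.run O) (O (q (t.run O)))} ≤
      (p : ℝ)⁻¹ := by
  have key : ∀ O, q (t.run O) ∉ t.queries O → ∀ y,
      t.run (Function.update O (q (t.run O)) y) = t.run O := fun O h y =>
    t.run_congr fun i hi => by rw [Function.update_of_ne (by rintro rfl; exact h hi)]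
  refine real_le_inv_of_update ?_ (fun O => q (t.run O)) (fun O hO y => ?_) fun O hO y hO' => ?_
  -- The event also depends on the value at the predicted point, so the tree is prolonged by that
  -- query to get a support.
  · obtain ⟨T, hT⟩ := (t.bind fun a => query (q a) fun _ => pure a).exists_support
    refine ⟨T, fun O O' h hO => ?_⟩
    have hT' : ∀ i, i ∈ t.queries O ∨ i = q (t.run O) → O i = O' i := fun i hi =>
      h i (hT O i (by simpa [queries] using hi))
    have h1 : ∀ i ∈ t.queries O, O i = O' i := fun i hi => hT' i (.inl hi)
    rw [Set.mem_ofPred_eq, t.run_congr h1, t.queries_congr h1, ← hT' _ (.inr rfl)]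
    exact hO
  · rw [key O hO.1]
  · have := hO'.2
    simp only [key O hO.1, Function.update_self] at this
    exact hP _ _ _ this hO.2

/-- The computation of the gates of a circuit that extends given values `g`. -/
def gates (x : List (List Bool)) : List Gate → List Bool → QTree p (List Bool)
  | [], g => pure g
  | .const b :: gs, g => gates x gs (g ++ [b])
  | .nand a b :: gs, g => gates x gs (g ++ [!(a.val x g && b.val x g)])
  | .hash t args bit :: gs, g =>
    query (t, args.map (Wire.val x g)) fun z => gates x gs (g ++ [z.val.testBit bit])

theorem run_gates (O : Fin 2 × List Bool → ZMod p) (x : List (List Bool)) (gs : List Gate)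
    (g : List Bool) : (gates x gs g).run O =
      gs.foldl (fun g a => g ++ [a.val (fun q => (O q).val) x g]) g := by
  induction gs generalizing g with
  | nil => rfl
  | cons a gs ih => cases a <;> simp [gates, run, ih, Gate.val]

theorem length_queries_gates_le (O : Fin 2 × List Bool → ZMod p) (x : List (List Bool))
    (gs : List Gate) (g : List Bool) : ((gates x gs g).queries O).length ≤ gatesSize gs := by
  induction gs generalizing g with
  | nil => simp [gates, queries]
  | cons a gs ih =>
    have hs : gatesSize (a :: gs) = a.size + gatesSize gs := by simp [gatesSize]
    rw [hs]
    cases a with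
    | const b => exact (ih _).trans (Nat.le_add_left _ _)
    | nand w w' => exact (ih _).trans (Nat.le_add_left _ _)
    | hash t args bit =>
      have := ih (g ++ [(O (t, args.map (Wire.val x g))).val.testBit bit])
      simp only [gates, queries, List.length_cons, Gate.size]
      omega

/-- Traces a query back to the hash gate `b` that makes it, whose wires see only the first `b`
values. A circuit can therefore read the query off these wires. -/
theorem mem_queries_gates {O : Fin 2 × List Bool → ZMod p} {x : List (List Bool)}
    (gs : List Gate) {i : Fin 2 × List Bool} (hi : i ∈ (gates x gs []).queries O) :
    ∃ b < gs.length, ∃ t args bit, gs[b]? = some (.hash t args bit) ∧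
      i = (t, args.map (Wire.val x ((runGates gs (fun q => (O q).val) x).take b))) := by
  have key : ∀ gs₀ gs : List Gate,
      i ∈ (gates x gs (runGates gs₀ (fun q => (O q).val) x)).queries O →
      ∃ b < (gs₀ ++ gs).length, ∃ t args bit, (gs₀ ++ gs)[b]? = some (.hash t args bit) ∧
        i = (t, args.map (Wire.val x ((runGates (gs₀ ++ gs) (fun q => (O q).val) x).take b))) := by
    intro gs₀ gs
    induction gs generalizing gs₀ with
    | nil => simp [gates, queries]
    | cons a gs ih =>
      intro h
      have ih' := ih (gs₀ ++ [a])
      rw [runGates_concat, List.append_assoc] at ih'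
      cases a with
      | const b => exact ih' h
      | nand w w' => exact ih' h
      | hash t args bit =>
        simp only [gates, queries, List.mem_cons] at h
        rcases h with rfl | h
        · refine ⟨gs₀.length, by simp, t, args, bit, by simp, ?_⟩
          rw [← runGates_take]
          simp
        · exact ih' h
  exact key [] gs hi

end QTree

/-- The computation of an algorithm. -/
def DetAlgorithm.tree {m : ℕ → ℕ} (A : DetAlgorithm m) (p n : ℕ) (x : List (List Bool)) :
    QTree p (Fin (m n) → List Bool) :=
  (QTree.gates x (A.circuit n).gates []).bind fun g =>
    .pure fun k => ((A.circuit n).outs k).map (Wire.val x g)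

@[simp]
theorem DetAlgorithm.run_tree {m : ℕ → ℕ} (A : DetAlgorithm m) {p n : ℕ}
    (O : Fin 2 × List Bool → ZMod p) (x : List (List Bool)) :
    (A.tree p n x).run O = A.out n O x := by
  funext k
  simp only [tree, QTree.run_bind, QTree.run_gates]
  rfl

theorem DetAlgorithm.queries_tree {m : ℕ → ℕ} (A : DetAlgorithm m) {p n : ℕ}
    (O : Fin 2 × List Bool → ZMod p) (x : List (List Bool)) :
    (A.tree p n x).queries O = (QTree.gates x (A.circuit n).gates []).queries O := by
  simp [tree, QTree.queries]

theorem DetAlgorithm.length_queries_le {m : ℕ → ℕ} (A : DetAlgorithm m) {p n : ℕ}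
    (O : Fin 2 × List Bool → ZMod p) (x : List (List Bool)) :
    ((A.tree p n x).queries O).length ≤ (A.circuit n).size := by
  rw [queries_tree]
  exact (QTree.length_queries_gates_le _ _ _ _).trans (Circuit.gatesSize_le _)

/-- The queries at the points of a finite family. -/
def queryAll {p : ℕ} : {k : ℕ} → (Fin k → Fin 2 × List Bool) → QTree p (Fin k → ZMod p)
  | 0, _ => .pure Fin.elim0
  | _ + 1, q => .query (q 0) fun z => (queryAll fun i => q i.succ).bind fun f => .pure (Fin.cons z f)

@[simp]
theorem run_queryAll {p : ℕ} (O : Fin 2 × List Bool → ZMod p) {k : ℕ}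
    (q : Fin k → Fin 2 × List Bool) : (queryAll q).run O = fun i => O (q i) := by
  induction k with
  | zero => funext i; exact i.elim0
  | succ k ih =>
    funext i
    simp only [queryAll, QTree.run, QTree.run_bind, ih]
    cases i using Fin.cases <;> simp

@[simp]
theorem queries_queryAll {p : ℕ} (O : Fin 2 × List Bool → ZMod p) {k : ℕ}
    (q : Fin k → Fin 2 × List Bool) : (queryAll q).queries O = List.ofFn q := by
  induction k with
  | zero => rfl
  | succ k ih => simp [queryAll, QTree.queries, ih, List.ofFn_succ]

/-! ## The commitment determines the values of the polynomial -/

section KZG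

variable {G GT : Type} [CommGroup G] [CommGroup GT] {p : ℕ} [Fact p.Prime]

/-- The degree bound is needed because `KZG.commit` ignores coefficients beyond `d`. -/
theorem commit_setup (hG : ∀ a : G, a ^ p = 1) {d : ℕ} (g : G) (α : ZMod p)
    (φ : Polynomial (ZMod p)) (hφ : φ.natDegree ≤ d) :
    KZG.commit (KZG.setup d g α) φ = g ^ (φ.eval α).val := by
  unfold KZG.commit KZG.setup
  rw [Polynomial.eval_eq_sum_range' (Nat.lt_succ_of_le hφ), pow_val_sum (hG g),
    ← Fin.prod_univ_eq_prod_range (fun i => g ^ (φ.coeff i * α ^ i).val)]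
  refine Finset.prod_congr rfl fun i _ => ?_
  rw [← pow_val_mul (hG g), mul_comm]

/-- In a group of prime order the pairing check is an equation in the exponent. -/
theorem VerifyEval.eq_pow [Fintype G] (hcard : Fintype.card G = p) (e : G →* G →* GT)
    (hnd : ∀ g : G, g ≠ 1 → e g g ≠ 1) {d : ℕ} (hd : 1 ≤ d) {g : G} (hg : g ≠ 1) {α j v : ZMod p}
    {C π : G} (h : KZG.VerifyEval e (KZG.setup d g α) C j v π) :
    C / g ^ v.val = π ^ (α - j).val := by
  have hG : ∀ a : G, a ^ p = 1 := fun a => by rw [← hcard]; exact pow_card_eq_one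
  have h0 : KZG.setup d g α 0 = g := by
    have : (1 : ZMod p).val = 1 := ZMod.val_one p
    simp [KZG.setup, this]
  have h1 : KZG.setup d g α 1 = g ^ α.val := by
    obtain ⟨d, rfl⟩ : ∃ d', d = d' + 1 := ⟨d - 1, by omega⟩
    simp [KZG.setup]
  unfold KZG.VerifyEval at h
  rw [h0, h1, ← pow_val_sub (hG g)] at h
  have h2 : e (C / g ^ v.val / π ^ (α - j).val) g = 1 := by
    rw [map_div, MonoidHom.div_apply, h, map_pow, map_pow, MonoidHom.pow_apply, div_self']
  have hord : orderOf g = p := orderOf_eq_prime (hG g) hg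
  -- The quotient of the two sides is some `g ^ t`. Its pairing with `g` is `e(g, g)^t = 1`, and
  -- `e(g, g)` has order `p`, so `p` divides `t`.
  obtain ⟨t, ht⟩ := mem_powers_iff_mem_zpowers.2 (mem_zpowers_of_prime_card
    (by rw [Nat.card_eq_fintype_card, hcard]) hg (g' := C / g ^ v.val / π ^ (α - j).val))
  simp only at ht
  rw [← ht, map_pow, MonoidHom.pow_apply] at h2
  have hord' : orderOf (e g g) = p := orderOf_eq_prime
    (by rw [← MonoidHom.pow_apply, ← map_pow, hG, map_one, MonoidHom.one_apply]) (hnd g hg)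
  have h3 := orderOf_dvd_of_pow_eq_one h2
  rw [hord', ← hord] at h3
  rw [orderOf_dvd_iff_pow_eq_one.1 h3] at ht
  exact (div_eq_one.1 ht.symm)

/-- A false evaluation with an accepted proof yields a solution of the strong Diffie–Hellman
problem. -/
theorem strongDH_solution (hG : ∀ a : G, a ^ p = 1) {d : ℕ} {g : G} (hg : g ≠ 1) {α j v : ZMod p}
    {π : G} (φ q : Polynomial (ZMod p)) (hφ : φ.natDegree ≤ d) (hq : q.natDegree ≤ d)
    (hφq : φ = (Polynomial.X - Polynomial.C j) * q + Polynomial.C (φ.eval j))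
    (hv : φ.eval j ≠ v)
    (h : KZG.commit (KZG.setup d g α) φ / g ^ v.val = π ^ (α - j).val) :
    α + -j ≠ 0 ∧ ((π * KZG.commit (KZG.setup d g α) q ^ (-1 : ZMod p).val) ^
      ((φ.eval j - v)⁻¹).val) ^ (α + -j).val = g := by
  rw [commit_setup hG g α φ hφ, ← pow_val_sub (hG g)] at h
  rw [commit_setup hG g α q hq, ← sub_eq_add_neg]
  have hδ : φ.eval j - v ≠ 0 := sub_ne_zero.2 hv
  -- With `δ = φ(j) - v` the hypothesis becomes `g^((α - j) q(α) + δ) = π^(α - j)`. Dividing by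
  -- `g^((α - j) q(α))` and raising to `1/δ` leaves `g`. If `α = j`, then `g^δ = 1` and hence `g =
  -- 1`.
  have he : φ.eval α - v = (α - j) * q.eval α + (φ.eval j - v) := by
    conv_lhs => rw [hφq]
    simp
    ring
  rw [he, pow_val_add (hG g)] at h
  have hg1 : (g ^ (φ.eval j - v).val) ^ ((φ.eval j - v)⁻¹).val = g := by
    rw [← pow_val_mul (hG g), mul_inv_cancel₀ hδ, ZMod.val_one, pow_one]
  constructor
  · intro h0
    rw [h0, zero_mul, ZMod.val_zero, pow_zero, pow_zero, one_mul] at h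
    rw [h, one_pow] at hg1
    exact hg hg1.symm
  · rw [← pow_mul, mul_comm (ZMod.val _), pow_mul, mul_pow, ← h, ← pow_val_mul (hG g),
      ← pow_val_mul (hG g), mul_right_comm, ← pow_val_add (hG g)]
    have : (α - j) * q.eval α + q.eval α * -1 * (α - j) = 0 := by ring
    rw [this, ZMod.val_zero, pow_zero, one_mul, hg1]

end KZG

/-! ### Interpolation of the batch and division by `X - j` -/

section Batch

variable {p : ℕ} [Fact p.Prime] {k : ℕ}

theorem natCast_injOn (hk : k ≤ p) :
    Set.InjOn (fun j : Fin k => ((j : ℕ) : ZMod p)) (Finset.univ : Finset (Fin k)) := by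
  intro i _ j _ h
  have := congrArg ZMod.val h
  simp only [] at this
  rw [ZMod.val_natCast_of_lt (by omega), ZMod.val_natCast_of_lt (by omega)] at this
  exact Fin.ext this

/-- The basis polynomials of the interpolation. -/
def node (p k : ℕ) [Fact p.Prime] (i : Fin k) : Polynomial (ZMod p) :=
  Lagrange.basis Finset.univ (fun j : Fin k => ((j : ℕ) : ZMod p)) i

/-- The quotient of the difference of a basis polynomial and its value at `j` by `X - j`. -/
def quot (p k : ℕ) [Fact p.Prime] (j : Fin k) (i : Fin k) : Polynomial (ZMod p) :=
  node p k i /ₘ (Polynomial.X - Polynomial.C ((j : ℕ) : ZMod p))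

theorem batchPoly_eq (O : Fin 2 × List Bool → ZMod p) (TX : Fin k → List Bool) :
    batchPoly O TX = ∑ i, Polynomial.C (O (0, TX i)) * node p k i := rfl

theorem batchPoly_eval (hk : k ≤ p) (O : Fin 2 × List Bool → ZMod p) (TX : Fin k → List Bool)
    (j : Fin k) : (batchPoly O TX).eval ((j : ℕ) : ZMod p) = O (0, TX j) :=
  Lagrange.eval_interpolate_at_node _ (natCast_injOn hk) (Finset.mem_univ j)

theorem natDegree_node_le (hk : k ≤ p) (i : Fin k) : (node p k i).natDegree ≤ k := by
  rw [node, Polynomial.natDegree_eq_of_degree_eq_some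
    (Lagrange.degree_basis (natCast_injOn hk) (Finset.mem_univ i))]
  simp

theorem natDegree_batchPoly_le (hk : k ≤ p) (O : Fin 2 × List Bool → ZMod p)
    (TX : Fin k → List Bool) : (batchPoly O TX).natDegree ≤ k := by
  rw [batchPoly_eq]
  exact Polynomial.natDegree_sum_le_of_forall_le _ _ fun i _ =>
    (Polynomial.natDegree_C_mul_le _ _).trans (natDegree_node_le hk i)

theorem natDegree_sum_quot_le (hk : k ≤ p) (j : Fin k) (y : Fin k → ZMod p) :
    (∑ i, Polynomial.C (y i) * quot p k j i).natDegree ≤ k :=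
  Polynomial.natDegree_sum_le_of_forall_le _ _ fun i _ => by
    refine (Polynomial.natDegree_C_mul_le _ _).trans ?_
    rw [quot, Polynomial.natDegree_divByMonic _ (Polynomial.monic_X_sub_C _)]
    exact (Nat.sub_le _ _).trans (natDegree_node_le hk i)

/-- Division with remainder by `X - j` is linear, so the quotient is a combination of the fixed
polynomials `quot p k j i` with the hashes as coefficients. It can thus be committed to by `lin`. -/
theorem batchPoly_eq_quot (O : Fin 2 × List Bool → ZMod p) (TX : Fin k → List Bool) (j : Fin k) :
    batchPoly O TX = (Polynomial.X - Polynomial.C ((j : ℕ) : ZMod p)) *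
      (∑ i, Polynomial.C (O (0, TX i)) * quot p k j i) +
        Polynomial.C ((batchPoly O TX).eval ((j : ℕ) : ZMod p)) := by
  rw [batchPoly_eq, Polynomial.eval_finsetSum, map_sum, Finset.mul_sum, ← Finset.sum_add_distrib]
  refine Finset.sum_congr rfl fun i _ => ?_
  have h := Polynomial.modByMonic_add_div (node p k i)
    (Polynomial.X - Polynomial.C ((j : ℕ) : ZMod p))
  rw [Polynomial.modByMonic_X_sub_C_eq_C_eval] at h
  conv_lhs => rw [← h]
  rw [Polynomial.eval_mul, Polynomial.eval_C, Polynomial.C_mul, quot]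
  ring

end Batch

/-! ## Costs -/

section Costs

variable (𝔾 : BilinearGroup)

theorem polyBounded_mulSize : PolyBounded (mulSize 𝔾) := 𝔾.mul_efficient.choose.poly

/-- The multiplication circuit has to output a whole encoding, so its size bounds the length of
encodings; `size_p_le` then bounds the bit length of `p`, since the encoding is injective on `p`
elements. -/
theorem encLen_le_mulSize (n : ℕ) : 𝔾.encLen n ≤ mulSize 𝔾 n := by
  have h := 𝔾.mul_efficient.choose_spec n (fun _ => 0) 1 1
  rw [← 𝔾.enc_length n (1 * 1), ← h]
  simp only [DetAlgorithm.out, Circuit.eval, List.length_map]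
  exact Circuit.length_out_le _ _

theorem polyBounded_encLen : PolyBounded 𝔾.encLen :=
  (polyBounded_mulSize 𝔾).mono (encLen_le_mulSize 𝔾)

theorem size_p_le (n : ℕ) : Nat.size (𝔾.p n) ≤ 𝔾.encLen n + 1 := by
  have h : Fintype.card (𝔾.G n) ≤ Fintype.card (List.Vector Bool (𝔾.encLen n)) :=
    Fintype.card_le_of_injective (fun a => ⟨𝔾.enc n a, 𝔾.enc_length n a⟩) fun a b h =>
      𝔾.enc_injective n (congrArg Subtype.val h)
  rw [𝔾.card_G, card_vector, Fintype.card_bool] at h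
  exact Nat.size_le.2 (h.trans_lt (Nat.pow_lt_pow_right one_lt_two (Nat.lt_succ_self _)))

theorem polyBounded_size_p : PolyBounded fun n => Nat.size (𝔾.p n) :=
  ((polyBounded_encLen 𝔾).add (.const 1)).mono (size_p_le 𝔾)

theorem PolyBounded.addCost {f : ℕ → ℕ} (hf : PolyBounded f) : PolyBounded fun n => addCost (f n) :=
  (PolyBounded.const 200).mul (hf.add (.const 2))

theorem PolyBounded.mulCost {f : ℕ → ℕ} (hf : PolyBounded f) : PolyBounded fun n => mulCost (f n) :=
  hf.mul (((PolyBounded.const 2).mul hf.addCost).add ((PolyBounded.const 4).mul hf))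

theorem PolyBounded.powCost {f : ℕ → ℕ} (hf : PolyBounded f) : PolyBounded fun n => powCost (f n) :=
  hf.mul (((PolyBounded.const 2).mul hf.mulCost).add ((PolyBounded.const 4).mul hf))

theorem polyBounded_gPowCost : PolyBounded (gPowCost 𝔾) :=
  (polyBounded_size_p 𝔾).mul (((PolyBounded.const 2).mul (polyBounded_mulSize 𝔾)).add
    ((PolyBounded.const 4).mul (polyBounded_encLen 𝔾)))

variable {D k : ℕ → ℕ}

theorem polyBounded_linCost (hD : PolyBounded D) (hk : PolyBounded k) :
    PolyBounded fun n => linCost 𝔾 (k n) (D n) n :=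
  hk.mul ((((hD.add (.const 1)).mul ((polyBounded_gPowCost 𝔾).add (polyBounded_mulSize 𝔾))).add
    (polyBounded_gPowCost 𝔾)).add (polyBounded_mulSize 𝔾))

theorem polyBounded_storeCost (hD : PolyBounded D) (hk : PolyBounded k) (B : Builder k) :
    PolyBounded (storeCost 𝔾 D B) :=
  B.store.poly.add ((hk.mul ((polyBounded_size_p 𝔾).mul ((PolyBounded.const 1).add
    (B.store.poly.mul ((B.store.poly.add (.const 1)).add (.const 4)))))).add
      (polyBounded_linCost 𝔾 hD hk))

end Costs

/-- The algorithm that consists of given circuits and does not use coins. -/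
def Algorithm.ofCircuits {m : ℕ → ℕ} (C : ∀ n, Circuit (m n)) (hC : PolyBounded fun n => (C n).size) :
    Algorithm m where
  circuit := C
  poly := hC
  coins := fun _ => 0
  coins_poly := .const 0

/-! ### The circuits of the three reductions -/

section Reductions

variable {𝔾 : BilinearGroup} {S : Snark} (D : ℕ → ℕ) {k : ℕ → ℕ} {B : Builder k} {n : ℕ}

/-- The response of the builder to the challenge `c`. -/
def response (O : Fin 2 × List Bool → ZMod (𝔾.p n)) (ω : History 𝔾 S B n) (c : List Bool)
    (ρ : Fin (B.respond.coins n) → Bool) : Fin 5 → List Bool :=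
  B.respond.out n O (view 𝔾 S D B O ω ++ [c]) ρ

/-- The builder proves a false value of the polynomial of the batch at `j`. -/
def FalseOpening (O : Fin 2 × List Bool → ZMod (𝔾.p n)) (ω : History 𝔾 S B n) (c : List Bool)
    (ρ : Fin (B.respond.coins n) → Bool) (j : ℕ) : Prop :=
  ∃ (hj : j < k n) (v : ZMod (𝔾.p n)) (π : 𝔾.G n), k n ≤ 𝔾.p n ∧ ω.1 ≠ 1 ∧
    response D O ω c ρ 1 = encScalar v ∧ response D O ω c ρ 2 = 𝔾.enc n π ∧
      KZG.VerifyEval (𝔾.e n) (srs 𝔾 S D B ω) (hiddenState 𝔾 S D B O ω) (j : ZMod (𝔾.p n)) v π ∧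
        O (0, part 𝔾 S D B O ω ⟨j, hj⟩) ≠ v

/-- The cost of the reduction to the strong Diffie–Hellman problem. -/
def strongDHCost (𝔾 : BilinearGroup) (S : Snark) (D : ℕ → ℕ) (B : Builder k) (n : ℕ) : ℕ :=
  (S.setup.circuit n).size + (storeCost 𝔾 D B n + (B.respond.circuit n).size) +
    ((mulCost (Nat.size (𝔾.p n)) + addCost (Nat.size (𝔾.p n)) + powCost (Nat.size (𝔾.p n))) +
      (linCost 𝔾 (k n) (D n) n + gPowCost 𝔾 n + mulSize 𝔾 n) + gPowCost 𝔾 n) + 2 +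
    (Nat.size (𝔾.p n) + 𝔾.encLen n)

/-- A solution of the strong Diffie–Hellman problem `(g, g^α, …)`. -/
def SolvesStrongDH (g : 𝔾.G n) (α : ZMod (𝔾.p n)) (out : Fin 2 → List Bool) : Prop :=
  ∃ (c : ZMod (𝔾.p n)) (h : 𝔾.G n), out 0 = encScalar c ∧ out 1 = 𝔾.enc n h ∧
    α + c ≠ 0 ∧ h ^ (α + c).val = g

/-- From `srs` alone the circuit runs the setup of the zk-SNARK and both stages of the builder, with
coins and challenge hard-wired, and evaluates the formula of `strongDH_solution`. The true value at
`j` is known, because the parts are computed on the way. -/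
theorem exists_strongDH_circuit (hk : k n ≤ D n) (τ : Fin (S.setup.coins n) → Bool)
    (σ : Fin (B.store.coins n) → Bool) (c : List Bool) (ρ : Fin (B.respond.coins n) → Bool) (j : ℕ) :
    ∃ C : Circuit 2, C.size ≤ strongDHCost 𝔾 S D B n ∧
      ∀ (O : Fin 2 × List Bool → ZMod (𝔾.p n)) (g : 𝔾.G n) (α : ZMod (𝔾.p n)),
        FalseOpening D O (g, α, τ, σ) c ρ j →
        SolvesStrongDH g α
          (C.eval (fun q => (O q).val) ([encSrs 𝔾 n (KZG.setup (D n) g α)] ++ [[]])) := by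
  by_cases hj : j < k n
  swap
  · exact ⟨⟨[], fun _ => []⟩, by simp [Circuit.size], fun O g α h => absurd h.1 hj⟩
  -- Only situations with a false opening matter. On this subtype `v` and `π` are functions of the
  -- situation and the difference to be inverted is nonzero.
  let Ω : Type := {x : (Fin 2 × List Bool → ZMod (𝔾.p n)) × 𝔾.G n × ZMod (𝔾.p n) //
    FalseOpening D x.1 ((x.2.1, x.2.2, τ, σ) : History 𝔾 S B n) c ρ j}
  let O : Ω → Fin 2 × List Bool → ZMod (𝔾.p n) := fun x => x.1.1
  let h : Ω → History 𝔾 S B n := fun x => (x.1.2.1, x.1.2.2, τ, σ)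
  let inp : Ω → List (List Bool) := fun x => [encSrs 𝔾 n (srs 𝔾 S D B (h x))] ++ [[]]
  have hx : ∀ x : Ω, FalseOpening D (O x) (h x) c ρ j := fun x => x.2
  choose hj' v π hkp hg hv hπ hver hne using hx
  have d1 : Der (natOracle O) inp (inBits inp) (paramBits D O h) (S.setup.circuit n).size := by
    have d := Der.circuit (orc := natOracle O) (inp := inp) (A := inBits inp) (S.setup.circuit n)
      (xs := fun _ => [] ++ [List.ofFn τ])
      (inBits_cons ((strBits_const _).trans Set.subset_union_right)
        (inBits_nil.trans Set.subset_union_right))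
    refine d.self_union.right (Set.union_subset ?_ (Set.union_subset ?_ ?_))
    · exact fun f hf => .inl (.inl (strBits_subset_inBits 0 (fun ω => rfl) hf))
    · exact fun f hf => .inl (.inr (Set.mem_iUnion.2 ⟨0, hf⟩))
    · exact fun f hf => .inl (.inr (Set.mem_iUnion.2 ⟨1, hf⟩))
  have d2 := d1.trans' (Der.response D O h σ (fun _ => rfl) c ρ)
  let y : Ω → Fin (k n) → ZMod (𝔾.p n) := fun ω i => O ω (0, part 𝔾 S D B (O ω) (h ω) i)
  let M : Set (Ω → Bool) := partHashBits D O h ∪ responseBits D O h c ρ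
  have my : ∀ i, zBits (fun ω => y ω i) ⊆ M := fun i f hf => .inl (Set.mem_iUnion.2 ⟨i, hf⟩)
  have mv : zBits v ⊆ M := fun f hf => .inr (Set.mem_iUnion.2 ⟨1, by
    rw [zBits_eq_strBits] at hf
    simp only [← hv] at hf
    exact hf⟩)
  have mπ : gBits 𝔾 π ⊆ M := fun f hf => .inr (Set.mem_iUnion.2 ⟨2, by
    have hf' : f ∈ strBits fun ω => 𝔾.enc n (π ω) := hf
    simp only [← hπ] at hf'
    exact hf'⟩)
  have d3 : Der (natOracle O) inp M (zBits fun ω => (y ω ⟨j, hj⟩ - v ω)⁻¹) _ :=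
    (Der.zInvSub (fun ω => y ω ⟨j, hj⟩) v hne).left (Set.union_subset (my _) mv)
  let κ : Fin (k n) → Fin (D n + 1) → ZMod (𝔾.p n) := fun i m =>
    (quot (𝔾.p n) (k n) ⟨j, hj⟩ i).coeff m
  have msrs : strBits (fun ω => encSrs 𝔾 n (srs 𝔾 S D B (h ω))) ⊆ inBits inp :=
    strBits_subset_inBits 0 fun ω => rfl
  have d4 := Der.lin (O := O) (inp := inp) (A := inBits inp ∪ M) (fun ω => srs 𝔾 S D B (h ω)) κ y
    (fun f hf => .inl (.inl (msrs hf))) fun i f hf => .inl (.inr (my i hf))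
  have d5 := d4.trans' (Der.gPow (x := fun _ => -1) Set.subset_union_left
    ((codeBits_const _ _).trans Set.subset_union_right))
  have d6 := d5.self_union.trans' ((Der.gMul π _).left
    (Set.union_subset_union_left _ (mπ.trans Set.subset_union_right)))
  have d7 := ((d3.left Set.subset_union_right).union d6).trans' (Der.gPow
    (a := fun ω => π ω * lin (srs 𝔾 S D B (h ω)) κ (y ω) ^ (-1 : ZMod (𝔾.p n)).val)
    (x := fun ω => (y ω ⟨j, hj⟩ - v ω)⁻¹)
    (fun f hf => .inl (.inr hf)) fun f hf => .inl (.inl hf))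
  have d8 := d2.trans d7
  let hh : Ω → 𝔾.G n := fun ω =>
    (π ω * lin (srs 𝔾 S D B (h ω)) κ (y ω) ^ (-1 : ZMod (𝔾.p n)).val) ^ ((y ω ⟨j, hj⟩ - v ω)⁻¹).val
  obtain ⟨C, hC, hout⟩ := d8.exists_circuit
    (fun i ω => ![encScalar (-(j : ZMod (𝔾.p n))), 𝔾.enc n (hh ω)] i)
    ![Nat.size (𝔾.p n), 𝔾.encLen n]
    (fun i ω => by
      fin_cases i
      · exact length_encScalar _
      · exact 𝔾.enc_length _ _)
    (fun i => by
      fin_cases i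
      · exact (strBits_const _).trans Set.subset_union_right
      · exact Set.subset_union_left)
  refine ⟨C, hC.trans (by simp [strongDHCost]), fun O' g α hF => ?_⟩
  let ω : Ω := ⟨(O', g, α), hF⟩
  have h0 : C.eval (fun q => (O' q).val) ([encSrs 𝔾 n (KZG.setup (D n) g α)] ++ [[]]) 0 = _ :=
    hout ω 0
  have h1 : C.eval (fun q => (O' q).val) ([encSrs 𝔾 n (KZG.setup (D n) g α)] ++ [[]]) 1 = _ :=
    hout ω 1
  refine ⟨-(j : ZMod (𝔾.p n)), hh ω, by rw [h0]; rfl, by rw [h1]; rfl, ?_⟩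
  -- `j < k n ≤ D n` gives `1 ≤ D n`; for `D n = 0` the index `1` of `srs` would wrap around to `0`.
  have heq := VerifyEval.eq_pow (𝔾.card_G n) (𝔾.e n) (𝔾.nondegenerate n)
    (by omega : 1 ≤ D n) (hg ω) (hver ω)
  have hy := batchPoly_eval (hkp ω) (O ω) (part 𝔾 S D B (O ω) (h ω)) ⟨j, hj⟩
  have := strongDH_solution 𝔾.pow_p (hg ω) (batchPoly (O ω) (part 𝔾 S D B (O ω) (h ω)))
    (∑ i, Polynomial.C (y ω i) * quot (𝔾.p n) (k n) ⟨j, hj⟩ i)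
    ((natDegree_batchPoly_le (hkp ω) _ _).trans hk) ((natDegree_sum_quot_le (hkp ω) _ _).trans hk)
    (batchPoly_eq_quot _ _ ⟨j, hj⟩) (by rw [hy]; exact hne ω) heq
  rw [← lin_eq_commit fun m => 𝔾.pow_p _, hy] at this
  exact this

/-- The cost of the prover that imitates a builder. -/
def proverCost (𝔾 : BilinearGroup) (D : ℕ → ℕ) (B : Builder k) (n : ℕ) : ℕ :=
  storeCost 𝔾 D B n + (B.respond.circuit n).size + 2 + (n + 3 * (B.respond.circuit n).size)

/-- A prover receives only `(pk, vk)`. Everything else, including `g`, `α` and the challenge, is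
hard-wired; the oracle and the setup coins `τ` stay free. -/
theorem exists_prover_circuit (g : 𝔾.G n) (α : ZMod (𝔾.p n)) (σ : Fin (B.store.coins n) → Bool)
    (c : List Bool) (hc : c.length = n) (ρ : Fin (B.respond.coins n) → Bool) :
    ∃ C : Circuit 4, C.size ≤ proverCost 𝔾 D B n ∧
      ∀ (O : Fin 2 × List Bool → ZMod (𝔾.p n)) (τ : Fin (S.setup.coins n) → Bool),
        C.eval (fun q => (O q).val)
            ([provingKey 𝔾 S B O (g, α, τ, σ), verificationKey 𝔾 S B O (g, α, τ, σ)] ++ [[]]) =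
          ![c, response D O (g, α, τ, σ) c ρ 1, response D O (g, α, τ, σ) c ρ 3,
            response D O (g, α, τ, σ) c ρ 4] := by
  let Ω : Type := (Fin 2 × List Bool → ZMod (𝔾.p n)) × (Fin (S.setup.coins n) → Bool)
  let O : Ω → Fin 2 × List Bool → ZMod (𝔾.p n) := fun x => x.1
  let h : Ω → History 𝔾 S B n := fun x => (g, α, x.2, σ)
  let inp : Ω → List (List Bool) := fun x =>
    [provingKey 𝔾 S B (O x) (h x), verificationKey 𝔾 S B (O x) (h x)] ++ [[]]
  have d := (Der.response (inp := inp) D O h σ (fun _ => rfl) c ρ).mono (A' := inBits inp)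
    (Set.union_subset ((strBits_const (encSrs 𝔾 n (KZG.setup (D n) g α))).trans
      Set.subset_union_right) (Set.union_subset
      (fun f hf => .inl (strBits_subset_inBits 0 (fun ω => rfl) hf))
      fun f hf => .inl (strBits_subset_inBits 1 (fun ω => rfl) hf)))
    Set.subset_union_left le_rfl
  let L : Fin 5 → ℕ := fun i => ((B.respond.circuit n).outs i).length
  have hL : ∀ i, L i ≤ (B.respond.circuit n).size := fun i => Circuit.length_out_le _ _
  have hresp : ∀ i, strBits (fun ω => response D (O ω) (h ω) c ρ i) ⊆
      (partHashBits D O h ∪ responseBits D O h c ρ) ∪ consts Ω := fun i f hf =>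
    .inl (.inr (Set.mem_iUnion.2 ⟨i, hf⟩))
  obtain ⟨C, hC, hout⟩ := d.exists_circuit
    (fun i ω => ![c, response D (O ω) (h ω) c ρ 1, response D (O ω) (h ω) c ρ 3,
      response D (O ω) (h ω) c ρ 4] i) ![n, L 1, L 3, L 4]
    (fun i ω => by
      fin_cases i
      · exact hc
      all_goals simp [response, Algorithm.out, DetAlgorithm.out, Circuit.eval, L])
    (fun i => by
      fin_cases i
      · exact (strBits_const c).trans Set.subset_union_right
      · exact hresp 1
      · exact hresp 3
      · exact hresp 4)
  refine ⟨C, hC.trans ?_, fun O' τ => funext fun i => hout (O', τ) i⟩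
  simp only [Fin.sum_univ_four, proverCost]
  have := hL 1
  have := hL 3
  have := hL 4
  simp
  omega

/-- The part `j` is the suffix of the query of the builder at the gate `b` after the challenge. -/
def QueriesPart (O : Fin 2 × List Bool → ZMod (𝔾.p n)) (ω : History 𝔾 S B n) (c : List Bool)
    (ρ : Fin (B.respond.coins n) → Bool) (b : ℕ) : Prop :=
  ∃ (j : Fin (k n)) (t : Fin 2) (args : List Wire) (bit : ℕ),
    (B.respond.circuit n).gates[b]? = some (.hash t args bit) ∧
      (1, c ++ part 𝔾 S D B O ω j) = (t, args.map (Wire.val (view 𝔾 S D B O ω ++ [c] ++ [List.ofFn ρ])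
        ((runGates (B.respond.circuit n).gates (fun q => (O q).val)
          (view 𝔾 S D B O ω ++ [c] ++ [List.ofFn ρ])).take b)))

/-- The circuit simulates the builder and outputs the arguments of gate `b` after the first `n`,
which carry `c`. No knowledge of the part is needed. -/
theorem exists_recovery_circuit (c : List Bool) (hc : c.length = n)
    (ρ : Fin (B.respond.coins n) → Bool) (b : ℕ) :
    ∃ C : Circuit 1, C.size ≤ 3 * (B.respond.circuit n).size + 3 ∧
      ∀ (O : Fin 2 × List Bool → ZMod (𝔾.p n)) (ω : History 𝔾 S B n), QueriesPart D O ω c ρ b →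
        ∃ j, unpad (C.eval (fun q => (O q).val) (view 𝔾 S D B O ω ++ [[]]) 0) =
          part 𝔾 S D B O ω j := by
  by_cases hb : ∃ t args bit, (B.respond.circuit n).gates[b]? = some (.hash t args bit)
  swap
  · refine ⟨⟨[], fun _ => []⟩, by simp [Circuit.size], fun O ω h => ?_⟩
    obtain ⟨j, t, args, bit, h, -⟩ := h
    exact absurd ⟨t, args, bit, h⟩ hb
  obtain ⟨t, args, bit, hb⟩ := hb
  let Ω : Type := (Fin 2 × List Bool → ZMod (𝔾.p n)) × History 𝔾 S B n
  let inp : Ω → List (List Bool) := fun x => view 𝔾 S D B x.1 x.2 ++ [[]]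
  let xs : Ω → List (List Bool) := fun x => view 𝔾 S D B x.1 x.2 ++ [c] ++ [List.ofFn ρ]
  let O : Ω → Fin 2 × List Bool → ZMod (𝔾.p n) := fun x => x.1
  have hxs : inBits xs ⊆ inBits inp ∪ consts Ω := by
    refine inBits_view_append (S := S) D O (fun x : Ω => x.2) c (List.ofFn ρ) fun f hf => .inl ?_
    obtain ⟨⟨s, i⟩, rfl⟩ := hf
    refine ⟨(s, i), ?_⟩
    funext ω
    dsimp only [inp]
    rcases lt_or_ge s 5 with hs | hs
    · rw [List.getD_append _ _ _ _ (by exact hs)]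
    · have h5 : (view 𝔾 S D B ω.1 ω.2).length = 5 := rfl
      rw [List.getD_append_right _ _ _ _ (by exact hs), h5,
        List.getD_eq_default (l := view 𝔾 S D B ω.1 ω.2) _ (by exact hs)]
      cases s - 5 <;> simp
  have d := (Der.simulate (orc := natOracle O) (inp := inp) (B.respond.circuit n).gates xs).mono hxs
    Set.subset_union_left le_rfl
  let w : Ω → List Bool := fun ω => (args.drop n).map (Wire.val (xs ω)
    ((runGates (B.respond.circuit n).gates (natOracle O ω) (xs ω)).take b))
  -- The final `true` is the padding mark that `unpad` removes.
  obtain ⟨C, hC, hout⟩ := d.exists_circuit (m := 1) (fun _ ω => w ω ++ [true])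
    (fun _ => (args.drop n).length + 1) (fun _ ω => by simp [w]) (fun _ => by
      rintro _ ⟨i, rfl⟩
      rcases lt_or_ge i (args.drop n).length with hi | hi
      · refine strBits_map_wires (B.respond.circuit n).gates (args.drop n) xs b ⟨i, ?_⟩
        funext ω
        dsimp only
        rw [List.getD_append _ _ _ _ (by simpa [w] using hi)]
      · refine .inr ⟨[true].getD (i - (args.drop n).length) false, ?_⟩
        funext ω
        dsimp only
        rw [List.getD_append_right _ _ _ _ (by simpa [w] using hi)]
        simp [w])
  refine ⟨C, hC.trans ?_, fun O' ω h => ?_⟩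
  · have h1 : args.length ≤ gatesSize (B.respond.circuit n).gates := by
      have hmem : (Gate.hash t args bit).size ∈ (B.respond.circuit n).gates.map Gate.size :=
        List.mem_map_of_mem (List.mem_of_getElem? hb)
      have := List.single_le_sum (fun _ _ => Nat.zero_le _) _ hmem
      simp only [Gate.size] at this
      unfold gatesSize
      omega
    have h2 := Circuit.gatesSize_le (B.respond.circuit n)
    simp only [List.length_drop, Finset.sum_const, Finset.card_univ, Fintype.card_fin, one_smul]
    omega
  · obtain ⟨j, t', args', bit', hb', heq⟩ := h
    rw [hb] at hb'
    simp only [Option.some.injEq, Gate.hash.injEq] at hb'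
    obtain ⟨rfl, rfl, rfl⟩ := hb'
    refine ⟨j, ?_⟩
    have h0 : C.eval (fun q => (O' q).val) (view 𝔾 S D B O' ω ++ [[]]) 0 = w (O', ω) ++ [true] :=
      hout (O', ω) 0
    rw [h0, show [true] = true :: List.replicate 0 false from rfl, unpad_pad]
    have h3 := congrArg (List.drop n) (congrArg Prod.snd heq)
    simp only [List.drop_append_of_le_length hc.ge, List.drop_of_length_le hc.le, List.nil_append] at h3
    rw [h3, ← List.map_drop]
    rfl

end Reductions

section Assembly

variable {𝔾 : BilinearGroup} {S : Snark} {D k : ℕ → ℕ} {B : Builder k}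

/-! ## The order of the group is superpolynomial -/

theorem prob_const {p : ℕ} [Fact p.Prime] {F : Type} [Fintype F] (E : F → Prop) [DecidablePred E] :
    prob p F (fun _ f => E f) = (Finset.univ.filter E).card / Fintype.card F := by
  unfold prob
  congr 1
  rw [Finset.card_filter, Nat.cast_sum]
  refine Finset.sum_congr rfl fun f _ => ?_
  by_cases h : E f <;> simp [h, MeasureTheory.measureReal_def]

/-- A constant answer `(0, h)` is right when `α ≠ 0` and `g = h ^ α`, that is for `p - 1` of the
`p²` pairs `(g, α)`. So `1/p` is at most twice a negligible probability. -/
theorem negligible_inv_p (hDH : StrongDH 𝔾 D) : Negligible fun n => ((𝔾.p n : ℕ) : ℝ)⁻¹ := by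
  classical
  have hex : ∀ n, ∃ g : 𝔾.G n, ∃ C : Circuit 2, C.size ≤ 2 + (Nat.size (𝔾.p n) + 𝔾.encLen n) ∧
      ∀ (O : Fin 2 × List Bool → ZMod (𝔾.p n)) (x : List (List Bool)),
        C.eval (fun q => (O q).val) x = ![encScalar (0 : ZMod (𝔾.p n)), 𝔾.enc n g] := by
    intro n
    let Ω : Type := (Fin 2 × List Bool → ZMod (𝔾.p n)) × List (List Bool)
    have d : Der (natOracle fun ω : Ω => ω.1) (fun ω => ω.2) (inBits fun ω : Ω => ω.2) ∅ 0 :=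
      Der.of_subset (by simp)
    obtain ⟨C, hC, hout⟩ := d.exists_circuit
      (fun i _ => ![encScalar (0 : ZMod (𝔾.p n)), 𝔾.enc n 1] i)
      ![Nat.size (𝔾.p n), 𝔾.encLen n]
      (fun i ω => by
        fin_cases i
        · exact length_encScalar _
        · exact 𝔾.enc_length _ _)
      (fun i => (strBits_const _).trans Set.subset_union_right)
    exact ⟨1, C, hC.trans (by simp), fun O x => funext fun i => hout (O, x) i⟩
  choose g C hC hout using hex
  let A := Algorithm.ofCircuits C (((PolyBounded.const 2).add ((polyBounded_size_p 𝔾).add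
    (polyBounded_encLen 𝔾))).mono hC)
  have hA := hDH A
  refine (hA.poly_mul (fun n => prob_nonneg) (.const 2)).mono (fun n => by positivity) fun n => ?_
  have hp := (𝔾.prime n).two_le
  refine le_trans ?_ (mul_le_mul_of_nonneg_left (prob_mono
    (E := fun _ ω => ω.2.1 ≠ 0 ∧ g n ^ ω.2.1.val = ω.1) fun O ω h => ⟨0, g n,
      congrFun (hout n O _) 0, congrFun (hout n O _) 1, by rw [add_zero]; exact h.1,
        by rw [add_zero]; exact h.2⟩) (by positivity))
  rw [prob_const]
  have hcard : 𝔾.p n - 1 ≤ (Finset.univ.filter fun ω : 𝔾.G n × ZMod (𝔾.p n) ×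
      (Fin (A.coins n) → Bool) => ω.2.1 ≠ 0 ∧ g n ^ ω.2.1.val = ω.1).card := by
    have : 𝔾.p n - 1 = (Finset.univ.erase (0 : ZMod (𝔾.p n))).card := by
      rw [Finset.card_erase_of_mem (Finset.mem_univ _), Finset.card_univ, ZMod.card]
    rw [this]
    refine Finset.card_le_card_of_injOn (fun α => (g n ^ α.val, α, fun _ => false)) ?_ ?_
    · intro α hα
      simp only [Finset.coe_erase, Set.mem_sdiff, Set.mem_singleton_iff] at hα
      simpa using hα.2
    · intro a _ b _ h
      exact congrArg (fun x => x.2.1) h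
  have hF : Fintype.card (𝔾.G n × ZMod (𝔾.p n) × (Fin (A.coins n) → Bool)) = 𝔾.p n * 𝔾.p n := by
    have : Fintype.card (Fin (A.coins n) → Bool) = 1 := Fintype.card_unique (α := Fin 0 → Bool)
    rw [Fintype.card_prod, Fintype.card_prod, this, 𝔾.card_G, ZMod.card, mul_one]
  rw [hF]
  have hp' : (0 : ℝ) < 𝔾.p n := by positivity
  have h2 : (𝔾.p n : ℝ) ≤ 2 * (Finset.univ.filter fun ω : 𝔾.G n × ZMod (𝔾.p n) ×
      (Fin (A.coins n) → Bool) => ω.2.1 ≠ 0 ∧ g n ^ ω.2.1.val = ω.1).card := by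
    exact_mod_cast (by omega : 𝔾.p n ≤ 2 * (Finset.univ.filter fun ω : 𝔾.G n × ZMod (𝔾.p n) ×
      (Fin (A.coins n) → Bool) => ω.2.1 ≠ 0 ∧ g n ^ ω.2.1.val = ω.1).card)
  push_cast
  rw [← mul_div_assoc, le_div_iff₀ (by positivity), ← mul_assoc, inv_mul_cancel₀ hp'.ne', one_mul]
  exact h2

/-! ## The events of the game -/

/-- The randomness of the game. -/
abbrev Randomness (𝔾 : BilinearGroup) (S : Snark) (B : Builder k) (n : ℕ) : Type :=
  History 𝔾 S B n × (Fin n → Bool) × (Fin (B.respond.coins n) → Bool)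

theorem prob_first_eq_one_le (n : ℕ) :
    prob (𝔾.p n) (Randomness 𝔾 S B n) (fun _ f => f.1.1 = 1) ≤ ((𝔾.p n : ℕ) : ℝ)⁻¹ := by
  classical
  let e : 𝔾.G n × ((ZMod (𝔾.p n) × (Fin (S.setup.coins n) → Bool) ×
      (Fin (B.store.coins n) → Bool)) × (Fin n → Bool) × (Fin (B.respond.coins n) → Bool)) ≃
      Randomness 𝔾 S B n := (Equiv.prodAssoc _ _ _).symm
  obtain ⟨f₂, h⟩ := exists_prob_le (p := 𝔾.p n) (E := fun _ f => f.1.1 = 1) e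
  refine h.trans ?_
  have := prob_const (p := 𝔾.p n) (fun g : 𝔾.G n => g = 1)
  rw [Finset.filter_eq' Finset.univ (1 : 𝔾.G n), if_pos (Finset.mem_univ _),
    Finset.card_singleton, 𝔾.card_G, Nat.cast_one, one_div] at this
  exact this.le

variable (D) in
/-- A response with a true value of the polynomial and a proof that is accepted, but with a false
second hash. -/
def FalseHash {n : ℕ} (O : Fin 2 × List Bool → ZMod (𝔾.p n)) (ω : History 𝔾 S B n) (c : List Bool)
    (ρ : Fin (B.respond.coins n) → Bool) : Prop :=
  ∃ (j : Fin (k n)) (v r : ZMod (𝔾.p n)), response D O ω c ρ 1 = encScalar v ∧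
    response D O ω c ρ 3 = encScalar r ∧
      S.Accepts n O (verificationKey 𝔾 S B O ω) c v r (response D O ω c ρ 4) ∧
        v = O (0, part 𝔾 S D B O ω j) ∧ r ≠ O (1, c ++ part 𝔾 S D B O ω j)

variable (D) in
/-- A response with the true second hash of the part `j`. -/
def TrueHash {n : ℕ} (O : Fin 2 × List Bool → ZMod (𝔾.p n)) (ω : History 𝔾 S B n) (c : List Bool)
    (ρ : Fin (B.respond.coins n) → Bool) (j : Fin (k n)) : Prop :=
  response D O ω c ρ 3 = encScalar (O (1, c ++ part 𝔾 S D B O ω j))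

/-- Outside the degenerate events, either `v` is false, or `v` is true and `r` is false, or `r` is
the true second hash. -/
theorem acceptProb_le (n : ℕ) : acceptProb 𝔾 S D B n ≤
    prob (𝔾.p n) (Randomness 𝔾 S B n) (fun _ f => f.1.1 = 1) +
    (prob (𝔾.p n) (Randomness 𝔾 S B n) (fun _ _ => 𝔾.p n < k n) +
    (prob (𝔾.p n) (Randomness 𝔾 S B n)
      (fun O f => ∃ j < k n, FalseOpening D O f.1 (List.ofFn f.2.1) f.2.2 j) +
    (prob (𝔾.p n) (Randomness 𝔾 S B n) (fun O f => FalseHash D O f.1 (List.ofFn f.2.1) f.2.2) +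
    prob (𝔾.p n) (Randomness 𝔾 S B n)
      (fun O f => ∃ j, TrueHash D O f.1 (List.ofFn f.2.1) f.2.2 j)))) := by
  refine le_trans (prob_mono fun O f h => ?_) (prob_or_le.trans (add_le_add_right
    (prob_or_le.trans (add_le_add_right (prob_or_le.trans (add_le_add_right prob_or_le _)) _)) _))
  obtain ⟨j, v, π, r, -, hv, hπ, hr, hacc, hver⟩ := h
  by_cases hg : f.1.1 = 1
  · exact .inl hg
  by_cases hkp : 𝔾.p n < k n
  · exact .inr (.inl hkp)
  by_cases hval : O (0, part 𝔾 S D B O f.1 j) = v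
  swap
  · exact .inr (.inr (.inl ⟨j, j.2, j.2, v, π, not_lt.1 hkp, hg, hv, hπ, hver, hval⟩))
  by_cases hhash : r = O (1, List.ofFn f.2.1 ++ part 𝔾 S D B O f.1 j)
  · exact .inr (.inr (.inr (.inr ⟨j, hr.trans (congrArg encScalar hhash)⟩)))
  · exact .inr (.inr (.inr (.inl ⟨j, v, r, hv, hr, hacc, hval.symm, hhash⟩)))

/-- The event is not random: when it occurs, the bound `k/p` exceeds `1`. -/
theorem prob_lt_le (n : ℕ) : prob (𝔾.p n) (Randomness 𝔾 S B n) (fun _ _ => 𝔾.p n < k n) ≤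
    k n * ((𝔾.p n : ℕ) : ℝ)⁻¹ := by
  have hp : (0 : ℝ) < 𝔾.p n := by exact_mod_cast (𝔾.prime n).pos
  by_cases h : 𝔾.p n < k n
  · refine prob_le_one.trans ?_
    rw [← div_eq_mul_inv, le_div_iff₀ hp, one_mul]
    exact_mod_cast h.le
  · simp only [h, prob_false]
    positivity

/-! ### False values of the polynomial -/

theorem polyBounded_strongDHCost (hD : PolyBounded D) (hk : PolyBounded k) :
    PolyBounded (strongDHCost 𝔾 S D B) := by
  have hp := polyBounded_size_p 𝔾
  have hl := polyBounded_linCost 𝔾 hD hk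
  exact (((S.setup.poly.add ((polyBounded_storeCost 𝔾 hD hk B).add B.respond.poly)).add
    (((hp.mulCost.add hp.addCost).add hp.powCost).add ((hl.add (polyBounded_gPowCost 𝔾)).add
      (polyBounded_mulSize 𝔾)) |>.add (polyBounded_gPowCost 𝔾))).add (.const 2)).add
        (hp.add (polyBounded_encLen 𝔾))

/-- Guessing `j` costs the factor `k n`. All randomness except `g`, `α` and the oracle is fixed at
its best value, and the resulting circuit attacks the strong Diffie–Hellman problem. -/
theorem negligible_falseOpening (hD : PolyBounded D) (hk : ∀ n, k n ≤ D n) (hDH : StrongDH 𝔾 D) :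
    Negligible fun n => prob (𝔾.p n) (Randomness 𝔾 S B n)
      fun O f => ∃ j < k n, FalseOpening D O f.1 (List.ofFn f.2.1) f.2.2 j := by
  have hkp : PolyBounded k := hD.mono hk
  choose j hj using fun n => exists_prob_exists_le (p := 𝔾.p n) (F := Randomness 𝔾 S B n) (k n)
    fun j O f => FalseOpening D O f.1 (List.ofFn f.2.1) f.2.2 j
  -- The factor `Fin 0 → Bool` is the coin space of the derandomised adversary; the second component
  -- of the product is what gets fixed.
  let e : ∀ n, (𝔾.G n × ZMod (𝔾.p n) × (Fin 0 → Bool)) × ((Fin (S.setup.coins n) → Bool) ×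
      (Fin (B.store.coins n) → Bool) × (Fin n → Bool) × (Fin (B.respond.coins n) → Bool)) ≃
      Randomness 𝔾 S B n := fun n =>
    { toFun := fun x => ((x.1.1, x.1.2.1, x.2.1, x.2.2.1), x.2.2.2.1, x.2.2.2.2)
      invFun := fun f => ((f.1.1, f.1.2.1, Fin.elim0), f.1.2.2.1, f.1.2.2.2, f.2.1, f.2.2)
      left_inv := fun x => by
        rw [Subsingleton.elim (Fin.elim0 : Fin 0 → Bool) x.1.2.2]
      right_inv := fun f => rfl }
  choose f₂ hf₂ using fun n => exists_prob_le (p := 𝔾.p n)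
    (E := fun O f => FalseOpening D O f.1 (List.ofFn f.2.1) f.2.2 (j n)) (e n)
  choose C hC hsol using fun n => exists_strongDH_circuit (𝔾 := 𝔾) (S := S) D (B := B) (hk n)
    (f₂ n).1 (f₂ n).2.1 (List.ofFn (f₂ n).2.2.1) (f₂ n).2.2.2 (j n)
  have hA := hDH (Algorithm.ofCircuits C ((polyBounded_strongDHCost hD hkp).mono hC))
  refine (hA.poly_mul (fun n => prob_nonneg) hkp).mono (fun n => prob_nonneg) fun n => ?_
  refine (hj n).trans (mul_le_mul_of_nonneg_left ((hf₂ n).trans ?_) (Nat.cast_nonneg _))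
  refine prob_mono fun O f hf => ?_
  obtain ⟨c, h, h0, h1, hne, hpow⟩ := hsol n O f.1 f.2.1 hf
  have hrho : List.ofFn f.2.2 = [] := List.ofFn_zero
  refine ⟨c, h, Eq.trans ?_ h0, Eq.trans ?_ h1, hne, hpow⟩
  · rw [← hrho]; rfl
  · rw [← hrho]; rfl

/-! ### False values of the second hash function -/

/-- Setup and store. -/
def storeTree (D : ℕ → ℕ) {n : ℕ} (ω : History 𝔾 S B n) :
    QTree (𝔾.p n) ((Fin 2 → List Bool) × (Fin (k n + 1) → List Bool)) :=
  (S.setup.tree (𝔾.p n) n ([] ++ [List.ofFn ω.2.2.1])).bind fun keys =>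
    (B.store.tree (𝔾.p n) n ([encSrs 𝔾 n (srs 𝔾 S D B ω), keys 0, keys 1] ++
      [List.ofFn ω.2.2.2])).bind fun y => .pure (keys, y)

theorem run_storeTree {n : ℕ} (O : Fin 2 × List Bool → ZMod (𝔾.p n)) (ω : History 𝔾 S B n) :
    (storeTree D ω).run O = (S.setup.out n O [] ω.2.2.1,
      B.store.out n O (publicParams 𝔾 S D B O ω) ω.2.2.2) := by
  simp only [storeTree, QTree.run_bind, DetAlgorithm.run_tree]
  rfl

theorem length_queries_storeTree_le {n : ℕ} (O : Fin 2 × List Bool → ZMod (𝔾.p n))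
    (ω : History 𝔾 S B n) : ((storeTree D ω).queries O).length ≤
      (S.setup.circuit n).size + (B.store.circuit n).size := by
  simp only [storeTree, QTree.queries_bind, QTree.queries, List.append_nil, List.length_append]
  exact add_le_add (DetAlgorithm.length_queries_le _ _ _) (DetAlgorithm.length_queries_le _ _ _)

/-- Setup, store, hashing of all the parts, extraction of a witness, and hashing of the witness. -/
def extractTree (D : ℕ → ℕ) (E : DetAlgorithm fun _ => 1) {n : ℕ} (ω : History 𝔾 S B n) :
    QTree (𝔾.p n) (ZMod (𝔾.p n)) :=
  (storeTree D ω).bind fun x =>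
    (queryAll fun j : Fin (k n) => (0, unpad (x.2 j.castSucc))).bind fun _ =>
      (E.tree (𝔾.p n) n [x.1 0, x.1 1, []]).bind fun w => .query (0, unpad (w 0)) .pure

/-- `extractTree` hashes all parts and the extracted witness, so a witness that differs from a part
but has the same hash is a collision among its queries. -/
theorem real_extract_collision_le (E : DetAlgorithm fun _ => 1) {n : ℕ} (ω : History 𝔾 S B n) :
    (randomOracle (𝔾.p n)).real {O | ∃ j, part 𝔾 S D B O ω j ≠
        unpad (E.out n O [provingKey 𝔾 S B O ω, verificationKey 𝔾 S B O ω, []] (0 : Fin 1)) ∧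
      O (0, part 𝔾 S D B O ω j) = O (0, unpad (E.out n O
        [provingKey 𝔾 S B O ω, verificationKey 𝔾 S B O ω, []] (0 : Fin 1)))} ≤
    (((S.setup.circuit n).size + (B.store.circuit n).size + k n + (E.circuit n).size + 1) *
      ((S.setup.circuit n).size + (B.store.circuit n).size + k n + (E.circuit n).size + 1) : ℕ) *
        ((𝔾.p n : ℕ) : ℝ)⁻¹ := by
  have hq : ∀ O, (extractTree D E ω).queries O = (storeTree D ω).queries O ++
      (List.ofFn (fun j => (0, part 𝔾 S D B O ω j)) ++
      ((E.tree (𝔾.p n) n [provingKey 𝔾 S B O ω, verificationKey 𝔾 S B O ω, []]).queries O ++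
        [(0, unpad (E.out n O [provingKey 𝔾 S B O ω, verificationKey 𝔾 S B O ω, []] (0 : Fin 1)))])) := by
    intro O
    simp only [extractTree, QTree.queries_bind, queries_queryAll, QTree.queries, run_storeTree,
      DetAlgorithm.run_tree]
    rfl
  refine le_trans ?_ ((extractTree D E ω).real_collision_le _ fun O => ?_)
  · refine MeasureTheory.measureReal_mono fun O hO => ?_
    obtain ⟨j, hne, h⟩ := hO
    refine ⟨_, ?_, _, ?_, fun he => hne (congrArg Prod.snd he), h⟩
    · rw [hq]; simp
    · rw [hq]; simp
  · rw [hq]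
    have h1 := length_queries_storeTree_le (D := D) O ω
    have h2 := E.length_queries_le O
      [provingKey 𝔾 S B O ω, verificationKey 𝔾 S B O ω, []] (n := n)
    simp only [List.length_append, List.length_ofFn, List.length_singleton]
    omega

/-- If the extracted `w` satisfies the relation, then `H₁(w) = v` is the hash of the part, but `H₂(c
‖ w) = r` is not the second hash of the part. So `w` differs from the part and `H₁` has a collision;
otherwise knowledge soundness fails. -/
theorem negligible_falseHash (hD : PolyBounded D) (hk : PolyBounded k)
    (hp : Negligible fun n => ((𝔾.p n : ℕ) : ℝ)⁻¹) (hS : KnowledgeSound 𝔾.p S) :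
    Negligible fun n => prob (𝔾.p n) (Randomness 𝔾 S B n)
      fun O f => FalseHash D O f.1 (List.ofFn f.2.1) f.2.2 := by
  let e : ∀ n, ((Fin (S.setup.coins n) → Bool) × (Fin 0 → Bool)) × (𝔾.G n × ZMod (𝔾.p n) ×
      (Fin (B.store.coins n) → Bool) × (Fin n → Bool) × (Fin (B.respond.coins n) → Bool)) ≃
      Randomness 𝔾 S B n := fun n =>
    { toFun := fun x => ((x.2.1, x.2.2.1, x.1.1, x.2.2.2.1), x.2.2.2.2.1, x.2.2.2.2.2)
      invFun := fun f => ((f.1.2.2.1, Fin.elim0), f.1.1, f.1.2.1, f.1.2.2.2, f.2.1, f.2.2)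
      left_inv := fun x => by
        rw [Subsingleton.elim (Fin.elim0 : Fin 0 → Bool) x.1.2]
      right_inv := fun f => rfl }
  choose f₂ hf₂ using fun n => exists_prob_le (p := 𝔾.p n)
    (E := fun O f => FalseHash D O f.1 (List.ofFn f.2.1) f.2.2) (e n)
  choose C hC hout using fun n => exists_prover_circuit (𝔾 := 𝔾) (S := S) D (B := B) (f₂ n).1
    (f₂ n).2.1 (f₂ n).2.2.1 (List.ofFn (f₂ n).2.2.2.1) (by simp) (f₂ n).2.2.2.2
  have hcost : PolyBounded (proverCost 𝔾 D B) :=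
    (((polyBounded_storeCost 𝔾 hD hk B).add B.respond.poly).add (.const 2)).add
      (PolyBounded.id.add ((PolyBounded.const 3).mul B.respond.poly))
  obtain ⟨E, hE⟩ := hS (Algorithm.ofCircuits C (hcost.mono hC))
  have hL := (((S.setup.poly.add B.store.poly).add hk).add E.poly).add (.const 1)
  refine (hE.add (hp.poly_mul (fun n => by positivity) (hL.mul hL))).mono (fun n => prob_nonneg)
    fun n => (hf₂ n).trans ?_
  let ω : (Fin (S.setup.coins n) → Bool) × (Fin 0 → Bool) → History 𝔾 S B n := fun f =>
    ((e n) (f, f₂ n)).1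
  refine le_trans ?_ (add_le_add_right (prob_le_of_forall (p := 𝔾.p n)
    (F := (Fin (S.setup.coins n) → Bool) × (Fin 0 → Bool)) (by positivity)
    fun f => real_extract_collision_le (D := D) E (ω f)) _)
  refine le_trans (prob_mono fun O f hf => ?_) prob_or_le
  obtain ⟨j, v, r, hv, hr, hacc, hvj, hrj⟩ := hf
  have hrho : List.ofFn f.2 = [] := List.ofFn_zero
  have hP : ∀ i, (Algorithm.ofCircuits C (hcost.mono hC)).out n O
      [S.setup.out n O [] f.1 0, S.setup.out n O [] f.1 1] f.2 i =
      ![List.ofFn (f₂ n).2.2.2.1, response D O (ω f) (List.ofFn (f₂ n).2.2.2.1) (f₂ n).2.2.2.2 1,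
        response D O (ω f) (List.ofFn (f₂ n).2.2.2.1) (f₂ n).2.2.2.2 3,
        response D O (ω f) (List.ofFn (f₂ n).2.2.2.1) (f₂ n).2.2.2.2 4] i := fun i => by
    have := congrFun (hout n O f.1) i
    rw [← hrho] at this
    exact this
  set w := unpad (E.out n O [provingKey 𝔾 S B O (ω f), verificationKey 𝔾 S B O (ω f), []] (0 : Fin 1))
  by_cases hrel : Rel O (List.ofFn (f₂ n).2.2.2.1) v r w
  · right
    refine ⟨j, ?_, hvj.symm.trans hrel.1⟩
    intro he
    apply hrj
    rw [hrel.2, ← he]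
    rfl
  · left
    have h0 := hP 0
    refine ⟨v, r, ?_, (hP 1).trans hv, (hP 2).trans hr, ?_, ?_⟩
    · rw [h0]; simp
    · rw [h0, hP 3]
      exact hacc
    · rw [h0]
      have hrel' : ¬ Rel O (List.ofFn (f₂ n).2.2.2.1) v r (unpad (E.out n O
          [provingKey 𝔾 S B O (ω f), verificationKey 𝔾 S B O (ω f), List.ofFn f.2] (0 : Fin 1))) := by
        rw [hrho]
        exact hrel
      exact hrel'

/-! ### True values of the second hash function -/

/-- The whole game up to the response. -/
def responseTree (D : ℕ → ℕ) {n : ℕ} (ω : History 𝔾 S B n) (c : List Bool)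
    (ρ : Fin (B.respond.coins n) → Bool) :
    QTree (𝔾.p n) ((Fin (k n) → List Bool) × List Bool) :=
  (storeTree D ω).bind fun x =>
    (queryAll fun j : Fin (k n) => (0, unpad (x.2 j.castSucc))).bind fun y =>
      (B.respond.tree (𝔾.p n) n ([encSrs 𝔾 n (srs 𝔾 S D B ω), x.1 0, x.1 1,
        𝔾.enc n (KZG.commit (srs 𝔾 S D B ω) (∑ i, Polynomial.C (y i) * node (𝔾.p n) (k n) i)),
        x.2 (Fin.last _)] ++ [c] ++ [List.ofFn ρ])).bind fun out =>
          .pure (fun j => unpad (x.2 j.castSucc), out 3)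

theorem run_responseTree {n : ℕ} (O : Fin 2 × List Bool → ZMod (𝔾.p n)) (ω : History 𝔾 S B n)
    (c : List Bool) (ρ : Fin (B.respond.coins n) → Bool) :
    (responseTree D ω c ρ).run O = (part 𝔾 S D B O ω, response D O ω c ρ 3) := by
  simp only [responseTree, QTree.run_bind, run_storeTree, run_queryAll, DetAlgorithm.run_tree,
    QTree.run]
  rfl

theorem queries_responseTree {n : ℕ} (O : Fin 2 × List Bool → ZMod (𝔾.p n)) (ω : History 𝔾 S B n)
    (c : List Bool) (ρ : Fin (B.respond.coins n) → Bool) :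
    (responseTree D ω c ρ).queries O = (storeTree D ω).queries O ++
      (List.ofFn (fun j => (0, part 𝔾 S D B O ω j)) ++
        (QTree.gates (view 𝔾 S D B O ω ++ [c] ++ [List.ofFn ρ])
          (B.respond.circuit n).gates []).queries O) := by
  simp only [responseTree, QTree.queries_bind, run_storeTree, run_queryAll, queries_queryAll,
    QTree.queries, List.append_nil, DetAlgorithm.queries_tree]
  rfl

/-- Either the point `c ‖ w_j` of `H₂` is never queried, and each `j` contributes a guess of
probability at most `1/p`, or it is queried by setup or store, or by the builder after the deletion.
-/
theorem prob_trueHash_le (n : ℕ) : prob (𝔾.p n) (Randomness 𝔾 S B n)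
      (fun O f => ∃ j, TrueHash D O f.1 (List.ofFn f.2.1) f.2.2 j) ≤
    k n * ((𝔾.p n : ℕ) : ℝ)⁻¹ +
    (prob (𝔾.p n) (Randomness 𝔾 S B n) (fun O f =>
      ∃ b < (S.setup.circuit n).size + (B.store.circuit n).size,
        ∃ s, ((storeTree D f.1).queries O)[b]? = some (1, List.ofFn f.2.1 ++ s)) +
    prob (𝔾.p n) (Randomness 𝔾 S B n) (fun O f =>
      ∃ b < (B.respond.circuit n).size, QueriesPart D O f.1 (List.ofFn f.2.1) f.2.2 b)) := by
  have h1 : prob (𝔾.p n) (Randomness 𝔾 S B n) (fun O f => ∃ j,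
      (1, List.ofFn f.2.1 ++ part 𝔾 S D B O f.1 j) ∉
        (responseTree D f.1 (List.ofFn f.2.1) f.2.2).queries O ∧
      TrueHash D O f.1 (List.ofFn f.2.1) f.2.2 j) ≤ k n * ((𝔾.p n : ℕ) : ℝ)⁻¹ := by
    refine prob_le_of_forall (by positivity) fun f => ?_
    have hj := fun j : Fin (k n) => (responseTree D f.1 (List.ofFn f.2.1) f.2.2).real_predict_le
      (fun a => (1, List.ofFn f.2.1 ++ a.1 j)) (fun a y => a.2 = encScalar y)
      (fun a y y' h h' => encScalar_injective (h.symm.trans h'))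
    simp only [run_responseTree] at hj
    calc _ ≤ (randomOracle (𝔾.p n)).real (⋃ j : Fin (k n), {O |
          (1, List.ofFn f.2.1 ++ part 𝔾 S D B O f.1 j) ∉
            (responseTree D f.1 (List.ofFn f.2.1) f.2.2).queries O ∧
          TrueHash D O f.1 (List.ofFn f.2.1) f.2.2 j}) :=
          MeasureTheory.measureReal_mono fun O hO => Set.mem_iUnion.2 hO
      _ ≤ ∑ _j : Fin (k n), ((𝔾.p n : ℕ) : ℝ)⁻¹ :=
          (MeasureTheory.measureReal_iUnion_fintype_le _).trans (Finset.sum_le_sum fun j _ => hj j)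
      _ = _ := by simp
  refine le_trans ?_ (add_le_add_left h1 _)
  refine le_trans (prob_mono fun O f h => ?_) (prob_or_le.trans (add_le_add_right prob_or_le _))
  obtain ⟨j, h⟩ := h
  by_cases hq : (1, List.ofFn f.2.1 ++ part 𝔾 S D B O f.1 j) ∈
      (responseTree D f.1 (List.ofFn f.2.1) f.2.2).queries O
  swap
  · exact .inl ⟨j, hq, h⟩
  right
  rw [queries_responseTree, List.mem_append, List.mem_append] at hq
  rcases hq with hq | hq | hq
  · obtain ⟨b, hb, he⟩ := List.mem_iff_getElem.1 hq
    exact .inl ⟨b, hb.trans_le (length_queries_storeTree_le O _), _,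
      by rw [List.getElem?_eq_getElem hb, he]⟩
  -- The hashing of the parts queries only `H₁`, whereas the point belongs to `H₂`.
  · simp at hq
  · obtain ⟨b, hb, t, args, bit, hg, he⟩ := QTree.mem_queries_gates _ hq
    refine .inr ⟨b, hb.trans_le ?_, j, t, args, bit, hg, he⟩
    have : (B.respond.circuit n).gates.length ≤ gatesSize (B.respond.circuit n).gates := by
      unfold gatesSize
      have := List.length_le_sum_of_one_le ((B.respond.circuit n).gates.map Gate.size) (by
        intro i hi
        obtain ⟨g, -, rfl⟩ := List.mem_map.1 hi
        cases g <;> simp [Gate.size])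
      simpa using this
    exact this.trans (Circuit.gatesSize_le _)

/-- The queries of setup and store do not depend on `c`. For a fixed position `b` at most one of the
`2 ^ n` challenges is the prefix of the query there. -/
theorem prob_early_query_le (n : ℕ) : prob (𝔾.p n) (Randomness 𝔾 S B n) (fun O f =>
      ∃ b < (S.setup.circuit n).size + (B.store.circuit n).size,
        ∃ s, ((storeTree D f.1).queries O)[b]? = some (1, List.ofFn f.2.1 ++ s)) ≤
    ((S.setup.circuit n).size + (B.store.circuit n).size : ℕ) * ((2 : ℝ) ^ n)⁻¹ := by
  obtain ⟨b, hb⟩ := exists_prob_exists_le (p := 𝔾.p n) (F := Randomness 𝔾 S B n)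
    ((S.setup.circuit n).size + (B.store.circuit n).size)
    fun b O f => ∃ s, ((storeTree D f.1).queries O)[b]? = some (1, List.ofFn f.2.1 ++ s)
  refine hb.trans (mul_le_mul_of_nonneg_left ?_ (Nat.cast_nonneg _))
  let e : (Fin n → Bool) × (History 𝔾 S B n × (Fin (B.respond.coins n) → Bool)) ≃
      Randomness 𝔾 S B n :=
    { toFun := fun x => (x.2.1, x.1, x.2.2)
      invFun := fun f => (f.2.1, f.1, f.2.2)
      left_inv := fun x => rfl
      right_inv := fun f => rfl }
  obtain ⟨f₂, h⟩ := exists_prob_le (p := 𝔾.p n) (E := fun O (f : Randomness 𝔾 S B n) => ∃ s,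
    ((storeTree D f.1).queries O)[b]? = some (1, List.ofFn f.2.1 ++ s)) e
  refine h.trans ?_
  have := sum_real_le_one (p := 𝔾.p n) (fun c : Fin n → Bool => {O | ∃ s,
    ((storeTree D f₂.1).queries O)[b]? = some (1, List.ofFn c ++ s)}) (fun c => ?_) ?_
  · unfold prob
    rw [Fintype.card_fun, Fintype.card_bool, Fintype.card_fin, Nat.cast_pow, Nat.cast_ofNat,
      ← one_div]
    gcongr
    exact this
  · refine Eq.mp ?_ ((storeTree D f₂.1).finitelyDetermined fun _ l => ∃ s y, l[b]? =
      some (1, List.ofFn c ++ s, y))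
    congr 1
    ext O
    constructor
    · rintro ⟨s, y, h⟩
      simp only [List.getElem?_map, Option.map_eq_some_iff] at h
      obtain ⟨i, hi, h⟩ := h
      simp only [Prod.mk.injEq] at h
      exact ⟨s, by rw [hi, ← h.1, ← h.2.1]⟩
    · rintro ⟨s, h⟩
      exact ⟨s, O (1, List.ofFn c ++ s), by simp [h]⟩
  · rintro c c' O ⟨s, h⟩ ⟨s', h'⟩
    rw [h] at h'
    simp only [Option.some.injEq, Prod.mk.injEq, true_and] at h'
    exact List.ofFn_injective (List.append_inj_left h' (by simp))

/-- The deletion hypothesis enters here: the recovery algorithm samples its own challenge and coins,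
fixed at their best values, and guesses the gate at the cost of a polynomial factor. -/
theorem negligible_late_query (hB : DeletesAllParts 𝔾 S D B) :
    Negligible fun n => prob (𝔾.p n) (Randomness 𝔾 S B n) fun O f =>
      ∃ b < (B.respond.circuit n).size, QueriesPart D O f.1 (List.ofFn f.2.1) f.2.2 b := by
  choose b hb using fun n => exists_prob_exists_le (p := 𝔾.p n) (F := Randomness 𝔾 S B n)
    (B.respond.circuit n).size fun b O f => QueriesPart D O f.1 (List.ofFn f.2.1) f.2.2 b
  let e : ∀ n, (History 𝔾 S B n × (Fin 0 → Bool)) × ((Fin n → Bool) ×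
      (Fin (B.respond.coins n) → Bool)) ≃ Randomness 𝔾 S B n := fun n =>
    { toFun := fun x => (x.1.1, x.2)
      invFun := fun f => ((f.1, Fin.elim0), f.2)
      left_inv := fun x => by
        rw [Subsingleton.elim (Fin.elim0 : Fin 0 → Bool) x.1.2]
      right_inv := fun f => rfl }
  choose f₂ hf₂ using fun n => exists_prob_le (p := 𝔾.p n)
    (E := fun O f => QueriesPart D O f.1 (List.ofFn f.2.1) f.2.2 (b n)) (e n)
  choose C hC hrec using fun n => exists_recovery_circuit (𝔾 := 𝔾) (S := S) D (B := B)
    (List.ofFn (f₂ n).1) (by simp) (f₂ n).2 (b n)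
  have hX := hB (Algorithm.ofCircuits C ((((PolyBounded.const 3).mul B.respond.poly).add
    (.const 3)).mono hC))
  refine (hX.poly_mul (fun n => prob_nonneg) B.respond.poly).mono (fun n => prob_nonneg) fun n => ?_
  refine (hb n).trans (mul_le_mul_of_nonneg_left ((hf₂ n).trans ?_) (Nat.cast_nonneg _))
  refine prob_mono fun O f hf => ?_
  have := hrec n O f.1 hf
  rw [← (List.ofFn_zero : List.ofFn f.2 = [])] at this
  exact this

end Assembly

end PoE

end

/-! ### The sum of all bounds -/

theorem mainTheorem3 (𝔾 : PoE.BilinearGroup) (D k : ℕ → ℕ) (hD : PoE.PolyBounded D)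
    (hk : ∀ n, k n ≤ D n) (hDH : PoE.StrongDH 𝔾 D)
    (S : PoE.Snark) (hS : PoE.KnowledgeSound 𝔾.p S)
    (B : PoE.Builder k) (hB : PoE.DeletesAllParts 𝔾 S D B) :
    PoE.Negligible (PoE.acceptProb 𝔾 S D B) := by
  have hkp : PoE.PolyBounded k := hD.mono hk
  have hp := PoE.negligible_inv_p hDH
  have hkinv := hp.poly_mul (fun n => by positivity) hkp
  have hearly := PoE.Negligible.inv_two_pow.poly_mul (fun n => by positivity)
    (S.setup.poly.add B.store.poly)
  refine PoE.Negligible.mono (hp.add (hkinv.add ((PoE.negligible_falseOpening (S := S) (B := B) hD hk hDH).add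
    ((PoE.negligible_falseHash (B := B) hD hkp hp hS).add
      (hkinv.add (hearly.add (PoE.negligible_late_query hB))))))) (fun n => PoE.prob_nonneg)
    fun n => (PoE.acceptProb_le n).trans ?_
  refine add_le_add (PoE.prob_first_eq_one_le n) (add_le_add (PoE.prob_lt_le n) (add_le_add le_rfl
    (add_le_add le_rfl ((PoE.prob_trueHash_le n).trans (add_le_add le_rfl
      (add_le_add (PoE.prob_early_query_le n) le_rfl))))))
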